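/- Let $M_0=\{(r,s)\in[0,1]^2 : r\in\{0,1\}\text{ or }s\in\{0,1\}\}$ be the boundary of the unit square. A square metric space is a metric space $X$ with all distances at most $2$, together with an injective map $S_X:M_0\to X$ such that $d_X(S_X(i,r),S_X(i,s))=|s-r|=d_X(S_X(r,i),S_X(s,i))$ for $i\in\{0,1\}$, $r,s\in[0,1]$, and $d_X(S_X(r,s),S_X(t,u))\ge|r-t|+|s-u|$ for $(r,s),(t,u)\in M_0$. Let $\mathsf{SquaMS}$ be the category of square metric spaces, whose morphisms $f:X\to Y$ are the maps with $d_Y(f(x),f(y))\le d_X(x,y)$ and $f\circ S_X=S_Y$. Let $N=\{0,1,2\}^2$. For a square metric space $X$ let $N\otimes X$ be the quotient of $N\times X$ by the equivalence relation $\sim$ generated by $((i,j),S_X(1,r))\sim((i+1,j),S_X(0,r))$ for $i\in\{0,1\}$, $j\in\{0,1,2\}$ and $((i,j),S_X(r,1))\sim((i,j+1),S_X(r,0))$ for $i\in\{0,1,2\}$, $j\in\{0,1\}$, where $r\in[0,1]$; write $n\otimes x$ for the class of $(n,x)$. It carries the quotient metric: the distance of $m\otimes x$ and $n\otimes y$ is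 the infimum, over all finite paths in $N\times X$ from $(m,x)$ to $(n,y)$, of the sum of the contributions of consecutive points, where two points related by $\sim$ contribute $0$, two other points $(k,z),(k,z')$ in the same copy contribute $\frac13 d_X(z,z')$, and two other points in different copies contribute $2$. Its boundary map is $S_{N\otimes X}(r,s)=(i,j)\otimes S_X(3r-i,3s-j)$ for any $(i,j)\in N$ with $3r-i,\,3s-j\in[0,1]$. With $(N\otimes f)(n\otimes x)=n\otimes f(x)$ this is an endofunctor $N\otimes-$ of $\mathsf{SquaMS}$. Let $C$ be the Cauchy completion functor on $\mathsf{SquaMS}$, with $S_{C(X)}$ the composite of $S_X$ with the canonical embedding $X\to C(X)$, and let $i_X:N\otimes C(X)\to C(N\otimes X)$ be the morphism that takes $n\otimes\lim_k x_k$ to $\lim_k (n\otimes x_k)$. Let $U_0=[0,1]^2$ with the taxicab metric $d((x,y),(x',y'))=|x-x'|+|y-y'|$ and the inclusion $M_0\to U_0$ as boundary map. **Theorem.** The functor $N\otimes-$ on $\mathsf{SquaMS}$ has an initial algebra. Let $(W,\lambda:N\otimes W\to W)$ be any initial algebra of $N\otimes-$, let $V=C(W)$ be the Cauchy completion of $W$,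 and let $\theta=C(\lambda)\circ i_W:N\otimes V\to V$. Then $\theta$ is an isomorphism, and $(V,\theta^{-1}:V\to N\otimes V)$ is a final coalgebra of $N\otimes-$: for every coalgebra $(B,\beta:B\to N\otimes B)$ there is a unique morphism $h:B\to V$ in $\mathsf{SquaMS}$ with $\theta^{-1}\circ h=(N\otimes h)\circ\beta$. Moreover, $V$ is isomorphic in $\mathsf{SquaMS}$ to $U_0$ with the taxicab metric. -/

import Mathlib

open CategoryTheory CategoryTheory.Limits

universe u

namespace SquareMetric

/-! ### The boundary of the unit square and square metric spaces -/

/-- The boundary of the unit square `[0,1]²`. -/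
def boundary : Set (ℝ × ℝ) :=
  {p | (p.1 = 0 ∨ p.1 = 1) ∧ p.2 ∈ Set.Icc (0 : ℝ) 1} ∪
    {p | p.1 ∈ Set.Icc (0 : ℝ) 1 ∧ (p.2 = 0 ∨ p.2 = 1)}

/-- The boundary of the unit square, as a type. -/
abbrev M0 : Type := boundary

/-- A square metric space: a metric space bounded by `2` with an injective map `S` from the
boundary of the unit square, such that distances along each of the four sides are those of the
unit interval (`dist_vertical`, `dist_horizontal`), and all distances between boundary points
dominate the taxicab distance (`taxi_le_dist`). -/
structure SquaMS : Type (u + 1) where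
  carrier : Type u
  [metric : MetricSpace carrier]
  S : M0 → carrier
  S_injective : Function.Injective S
  dist_le_two : ∀ x y : carrier, dist x y ≤ 2
  dist_vertical : ∀ p q : M0, p.1.1 = q.1.1 → (p.1.1 = 0 ∨ p.1.1 = 1) →
    dist (S p) (S q) = |q.1.2 - p.1.2|
  dist_horizontal : ∀ p q : M0, p.1.2 = q.1.2 → (p.1.2 = 0 ∨ p.1.2 = 1) →
    dist (S p) (S q) = |q.1.1 - p.1.1|
  taxi_le_dist : ∀ p q : M0, |p.1.1 - q.1.1| + |p.1.2 - q.1.2| ≤ dist (S p) (S q)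

attribute [instance] SquaMS.metric

/-- Morphisms of square metric spaces: short maps that preserve the boundary maps. -/
@[ext]
structure SquaMS.Hom (X Y : SquaMS.{u}) : Type u where
  toFun : X.carrier → Y.carrier
  short : ∀ x y, dist (toFun x) (toFun y) ≤ dist x y
  map_S : ∀ p : M0, toFun (X.S p) = Y.S p

instance : Category.{u} SquaMS.{u} where
  Hom X Y := SquaMS.Hom X Y
  id X := ⟨fun x => x, fun _ _ => le_rfl, fun _ => rfl⟩
  comp f g := ⟨fun x => g.toFun (f.toFun x),
    fun x y => (g.short _ _).trans (f.short x y),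
    fun p => by rw [f.map_S, g.map_S]⟩

/-! ### The set `N ⊗ X` -/

/-- The nine positions `(column, row)` of the `3 × 3` grid. -/
abbrev N : Type := Fin 3 × Fin 3

/-- The generating identifications between boundary points of the nine cells: the right side of a
cell is glued to the left side of its right neighbour, and the top side of a cell is glued to the
bottom side of its upper neighbour. -/
inductive GridGlue : N × M0 → N × M0 → Prop
  | horizontal (i i' j : Fin 3) (h : i'.val = i.val + 1) (p q : M0)
      (hp : p.1.1 = 1) (hq : q.1.1 = 0) (hpq : p.1.2 = q.1.2) :
      GridGlue ((i, j), p) ((i', j), q)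
  | vertical (i j j' : Fin 3) (h : j'.val = j.val + 1) (p q : M0)
      (hp : p.1.2 = 1) (hq : q.1.2 = 0) (hpq : p.1.1 = q.1.1) :
      GridGlue ((i, j), p) ((i, j'), q)

variable (X Y Z : SquaMS.{u})

/-- The generating identifications on `N × X`. -/
def Glue (a b : N × X.carrier) : Prop :=
  ∃ p q : M0, GridGlue (a.1, p) (b.1, q) ∧ a.2 = X.S p ∧ b.2 = X.S q

/-- The equivalence relation on `N × X` generated by the identifications. -/
def glueSetoid : Setoid (N × X.carrier) := Relation.EqvGen.setoid (Glue X)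

/-- The underlying set of `N ⊗ X`. -/
def Tensor : Type u := Quotient (glueSetoid X)

variable {X Y Z} in
/-- The element `n ⊗ x`. -/
def tmk (n : N) (x : X.carrier) : Tensor X := Quotient.mk (glueSetoid X) (n, x)

/-! ### The quotient metric -/

/-- The distance on `N × X`: the distance of `X` scaled by `1/3` in each copy, and `2` between
different copies. -/
noncomputable def cellDist (a b : N × X.carrier) : ℝ :=
  if a.1 = b.1 then dist a.2 b.2 / 3 else 2

open scoped Classical in
/-- The contribution of two consecutive points to the score of a path: `0` if they are
identified, and their distance in `N × X` otherwise. -/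
noncomputable def step (a b : N × X.carrier) : ℝ :=
  if (glueSetoid X) a b then 0 else cellDist X a b

/-- `PathScore X a b s`: there is a finite path in `N × X` from `a` to `b` with score `s`. -/
inductive PathScore : N × X.carrier → N × X.carrier → ℝ → Prop
  | nil (a : N × X.carrier) : PathScore a a 0
  | cons {a b c : N × X.carrier} {s : ℝ} (h : PathScore b c s) : PathScore a c (step X a b + s)

/-- The infimum of the scores of the finite paths from `a` to `b`. -/
noncomputable def pathDist (a b : N × X.carrier) : ℝ := sInf {s | PathScore X a b s}

theorem cellDist_nonneg (a b : N × X.carrier) : 0 ≤ cellDist X a b := by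
  unfold cellDist; split_ifs <;> positivity

theorem cellDist_le_two (a b : N × X.carrier) : cellDist X a b ≤ 2 := by
  unfold cellDist
  split_ifs
  · have := X.dist_le_two a.2 b.2
    linarith
  · exact le_rfl

theorem cellDist_comm (a b : N × X.carrier) : cellDist X a b = cellDist X b a := by
  unfold cellDist; simp only [eq_comm, dist_comm]

theorem step_nonneg (a b : N × X.carrier) : 0 ≤ step X a b := by
  unfold step; split_ifs
  · exact le_rfl
  · exact cellDist_nonneg X a b

theorem step_le_cellDist (a b : N × X.carrier) : step X a b ≤ cellDist X a b := by
  unfold step; split_ifs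
  · exact cellDist_nonneg X a b
  · exact le_rfl

theorem step_comm (a b : N × X.carrier) : step X a b = step X b a := by
  have h : (glueSetoid X) a b ↔ (glueSetoid X) b a :=
    ⟨fun h => (glueSetoid X).symm h, fun h => (glueSetoid X).symm h⟩
  unfold step
  by_cases h' : (glueSetoid X) a b
  · rw [if_pos h', if_pos (h.1 h')]
  · rw [if_neg h', if_neg (fun h'' => h' (h.2 h'')), cellDist_comm]

theorem step_of_rel {a b : N × X.carrier} (h : (glueSetoid X) a b) : step X a b = 0 := by
  unfold step; simp [h]

variable {X}

theorem PathScore.nonneg {a b : N × X.carrier} {s : ℝ} (h : PathScore X a b s) : 0 ≤ s := by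
  induction h with
  | nil a => exact le_rfl
  | cons h ih => exact add_nonneg (step_nonneg X _ _) ih

theorem PathScore.single (a b : N × X.carrier) : PathScore X a b (step X a b) := by
  simpa using PathScore.cons (a := a) (PathScore.nil (X := X) b)

theorem PathScore.append {a b c : N × X.carrier} {s t : ℝ} (h : PathScore X a b s)
    (h' : PathScore X b c t) : PathScore X a c (s + t) := by
  induction h with
  | nil a => simpa using h'
  | cons h ih =>
    rw [add_assoc]
    exact PathScore.cons (ih h')

theorem PathScore.symm {a b : N × X.carrier} {s : ℝ} (h : PathScore X a b s) :
    PathScore X b a s := by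
  induction h with
  | nil a => exact PathScore.nil a
  | @cons a b c s h ih =>
    have := ih.append (PathScore.single b a)
    rwa [step_comm, add_comm] at this

theorem bddBelow_scores (a b : N × X.carrier) : BddBelow {s | PathScore X a b s} :=
  ⟨0, fun _ h => PathScore.nonneg h⟩

theorem scores_nonempty (a b : N × X.carrier) : {s | PathScore X a b s}.Nonempty :=
  ⟨_, PathScore.single a b⟩

theorem pathDist_nonneg (a b : N × X.carrier) : 0 ≤ pathDist X a b :=
  le_csInf (scores_nonempty a b) fun _ h => PathScore.nonneg h

theorem pathDist_le_step (a b : N × X.carrier) : pathDist X a b ≤ step X a b :=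
  csInf_le (bddBelow_scores a b) (PathScore.single a b)

theorem pathDist_le_two (a b : N × X.carrier) : pathDist X a b ≤ 2 :=
  (pathDist_le_step a b).trans ((step_le_cellDist X a b).trans (cellDist_le_two X a b))

theorem pathDist_of_rel {a b : N × X.carrier} (h : (glueSetoid X) a b) : pathDist X a b = 0 :=
  le_antisymm ((pathDist_le_step a b).trans (step_of_rel X h).le) (pathDist_nonneg a b)

theorem pathDist_comm (a b : N × X.carrier) : pathDist X a b = pathDist X b a := by
  unfold pathDist
  congr 1
  ext s
  exact ⟨PathScore.symm, PathScore.symm⟩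

theorem pathDist_triangle (a b c : N × X.carrier) :
    pathDist X a c ≤ pathDist X a b + pathDist X b c := by
  refine le_of_forall_pos_le_add fun ε hε => ?_
  obtain ⟨s, hs, hs'⟩ := exists_lt_of_csInf_lt (scores_nonempty a b)
    (lt_add_of_pos_right (pathDist X a b) (half_pos hε))
  obtain ⟨t, ht, ht'⟩ := exists_lt_of_csInf_lt (scores_nonempty b c)
    (lt_add_of_pos_right (pathDist X b c) (half_pos hε))
  have := csInf_le (bddBelow_scores a c) (PathScore.append hs ht)
  change pathDist X a c ≤ s + t at this
  linarith

theorem pathDist_congr {a a' b b' : N × X.carrier} (h : (glueSetoid X) a a')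
    (h' : (glueSetoid X) b b') : pathDist X a b = pathDist X a' b' := by
  apply le_antisymm
  · have h1 := pathDist_triangle a a' b
    have h2 := pathDist_triangle a' b' b
    rw [pathDist_of_rel h] at h1
    rw [pathDist_of_rel ((glueSetoid X).symm h')] at h2
    linarith
  · have h1 := pathDist_triangle a' a b'
    have h2 := pathDist_triangle a b b'
    rw [pathDist_of_rel ((glueSetoid X).symm h)] at h1
    rw [pathDist_of_rel h'] at h2
    linarith

/-- A map on `N × X` that respects the identifications takes equal values on identified points. -/
theorem eq_of_rel {β : Type*} {F : N × X.carrier → β} (hF : ∀ a b, Glue X a b → F a = F b)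
    {a b : N × X.carrier} (h : (glueSetoid X) a b) : F a = F b := by
  change Relation.EqvGen (Glue X) a b at h
  induction h with
  | rel a b h => exact hF a b h
  | refl a => rfl
  | symm a b _ ih => exact ih.symm
  | trans a b c _ _ ih ih' => exact ih.trans ih'

/-- A map on `N × X` that respects the identifications, is `1/3`-Lipschitz on each copy and has
an image of diameter at most `2` is short for the quotient distance. -/
theorem dist_le_pathDist {β : Type*} [PseudoMetricSpace β] {F : N × X.carrier → β}
    (hF : ∀ a b, Glue X a b → F a = F b)
    (hcell : ∀ n x y, dist (F (n, x)) (F (n, y)) ≤ dist x y / 3)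
    (hbdd : ∀ a b, dist (F a) (F b) ≤ 2) (a b : N × X.carrier) :
    dist (F a) (F b) ≤ pathDist X a b := by
  have hstep : ∀ a b, dist (F a) (F b) ≤ step X a b := by
    intro a b
    unfold step
    split_ifs with h
    · rw [eq_of_rel hF h, dist_self]
    · unfold cellDist
      split_ifs with h'
      · obtain ⟨n, x⟩ := a
        obtain ⟨m, y⟩ := b
        obtain rfl : n = m := h'
        exact hcell n x y
      · exact hbdd a b
  refine le_csInf (scores_nonempty a b) fun s hs => ?_
  change PathScore X a b s at hs
  induction hs with
  | nil a => simp
  | @cons a b c s h ih =>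
    exact (dist_triangle _ (F b) _).trans (add_le_add (hstep a b) ih)

/-! ### Boundary points of the cells are identified exactly when they have the same position -/

/-- Three times the position in the unit square of the boundary point `p` of the cell `n`. -/
def pos (n : N) (p : M0) : ℝ × ℝ := ((n.1.val : ℝ) + p.1.1, (n.2.val : ℝ) + p.1.2)

theorem M0.fst_mem (p : M0) : p.1.1 ∈ Set.Icc (0 : ℝ) 1 := by
  obtain ⟨p, (⟨h | h, h'⟩ | ⟨h, h'⟩)⟩ := p <;> simp_all

theorem M0.snd_mem (p : M0) : p.1.2 ∈ Set.Icc (0 : ℝ) 1 := by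
  obtain ⟨p, (⟨h, h'⟩ | ⟨h', h | h⟩)⟩ := p <;> simp_all

theorem coord_cases {i k : ℕ} {r t : ℝ} (hr : r ∈ Set.Icc (0 : ℝ) 1) (ht : t ∈ Set.Icc (0 : ℝ) 1)
    (h : (i : ℝ) + r = k + t) :
    (i = k ∧ r = t) ∨ (k = i + 1 ∧ r = 1 ∧ t = 0) ∨ (i = k + 1 ∧ t = 1 ∧ r = 0) := by
  rcases lt_trichotomy i k with hik | hik | hik
  · right; left
    have h1 : (i : ℝ) + 1 ≤ k := by exact_mod_cast hik
    have h2 : (k : ℝ) = i + 1 := by linarith [hr.2, ht.1]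
    exact ⟨by exact_mod_cast h2, by linarith [hr.2, ht.1], by linarith [hr.2, ht.1]⟩
  · left
    subst hik
    exact ⟨rfl, by linarith⟩
  · right; right
    have h1 : (k : ℝ) + 1 ≤ i := by exact_mod_cast hik
    have h2 : (i : ℝ) = k + 1 := by linarith [hr.1, ht.2]
    exact ⟨by exact_mod_cast h2, by linarith [hr.1, ht.2], by linarith [hr.1, ht.2]⟩

theorem tmk_eq_of_glue {n m : N} {p q : M0} (h : GridGlue (n, p) (m, q)) :
    tmk n (X.S p) = tmk m (X.S q) :=
  Quotient.sound (s := glueSetoid X) (Relation.EqvGen.rel _ _ ⟨p, q, h, rfl, rfl⟩)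

theorem tmk_eq_of_same_column {i j l : Fin 3} {p q : M0}
    (hx : p.1.1 = q.1.1) (hy : (j.val : ℝ) + p.1.2 = l.val + q.1.2) :
    tmk (i, j) (X.S p) = tmk (i, l) (X.S q) := by
  rcases coord_cases p.snd_mem q.snd_mem hy with ⟨h, h'⟩ | ⟨h, h1, h2⟩ | ⟨h, h1, h2⟩
  · obtain rfl : j = l := Fin.ext h
    obtain rfl : p = q := Subtype.ext (Prod.ext hx h')
    rfl
  · exact tmk_eq_of_glue (GridGlue.vertical i j l h p q h1 h2 hx)
  · exact (tmk_eq_of_glue (GridGlue.vertical i l j h q p h1 h2 hx.symm)).symm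

theorem tmk_eq_of_pos_eq {n m : N} {p q : M0} (h : pos n p = pos m q) :
    tmk n (X.S p) = tmk m (X.S q) := by
  obtain ⟨i, j⟩ := n
  obtain ⟨k, l⟩ := m
  have hx : (i.val : ℝ) + p.1.1 = k.val + q.1.1 := congrArg Prod.fst h
  have hy : (j.val : ℝ) + p.1.2 = l.val + q.1.2 := congrArg Prod.snd h
  rcases coord_cases p.fst_mem q.fst_mem hx with ⟨h, h'⟩ | ⟨h, h1, h2⟩ | ⟨h, h1, h2⟩
  · obtain rfl : i = k := Fin.ext h
    exact tmk_eq_of_same_column h' hy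
  · let p' : M0 := ⟨(0, p.1.2), Or.inl ⟨Or.inl rfl, p.snd_mem⟩⟩
    have e1 : tmk (i, j) (X.S p) = tmk (k, j) (X.S p') :=
      tmk_eq_of_glue (GridGlue.horizontal i k j h p p' h1 rfl rfl)
    rw [e1]
    exact tmk_eq_of_same_column h2.symm hy
  · let p' : M0 := ⟨(1, p.1.2), Or.inl ⟨Or.inr rfl, p.snd_mem⟩⟩
    have e1 : tmk (k, j) (X.S p') = tmk (i, j) (X.S p) :=
      tmk_eq_of_glue (GridGlue.horizontal k i j h p' p rfl h2 rfl)
    rw [← e1]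
    exact tmk_eq_of_same_column h1.symm hy

theorem pos_eq_of_glue {n m : N} {p q : M0} (h : GridGlue (n, p) (m, q)) : pos n p = pos m q := by
  cases h with
  | horizontal i i' j h _ _ hp hq hpq => simp [pos, h, hp, hq, hpq]
  | vertical i j j' h _ _ hp hq hpq => simp [pos, h, hp, hq, hpq]

/-! ### Short functions on `N ⊗ X`, and the resulting lower bounds of the quotient distance -/

/-- For signs `a`, `b`, the function `S (r, s) ↦ a * r + b * s` extends to a short function on
`X` with values in an interval of length `2`. -/
theorem exists_short (X : SquaMS.{u}) (a b : ℝ) (ha : |a| = 1) (hb : |b| = 1) :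
    ∃ g : X.carrier → ℝ, (∀ x y, dist (g x) (g y) ≤ dist x y) ∧
      (∀ p : M0, g (X.S p) = a * p.1.1 + b * p.1.2) ∧
      ∀ x, g x ∈ Set.Icc (min a 0 + min b 0) (max a 0 + max b 0) := by
  have hbd : ∀ p : M0, a * p.1.1 + b * p.1.2 ∈
      Set.Icc (min a 0 + min b 0) (max a 0 + max b 0) := by
    intro p
    have h1 := p.fst_mem
    have h2 := p.snd_mem
    rcases eq_or_eq_neg_of_abs_eq ha with rfl | rfl <;>
      rcases eq_or_eq_neg_of_abs_eq hb with rfl | rfl <;>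
      norm_num <;> constructor <;> linarith [h1.1, h1.2, h2.1, h2.2]
  have hle : min a 0 + min b 0 ≤ max a 0 + max b 0 :=
    add_le_add (min_le_of_right_le (le_max_right _ _)) (min_le_of_right_le (le_max_right _ _))
  let f : X.carrier → ℝ := fun x =>
    a * (Function.extend X.S (fun p => p.1.1) 0 x) + b * (Function.extend X.S (fun p => p.1.2) 0 x)
  have hf : ∀ p, f (X.S p) = a * p.1.1 + b * p.1.2 := by
    intro p
    simp [f, X.S_injective.extend_apply]
  have hLip : LipschitzOnWith 1 f (Set.range X.S) := by
    refine LipschitzOnWith.of_dist_le_mul ?_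
    rintro _ ⟨p, rfl⟩ _ ⟨q, rfl⟩
    rw [hf, hf, NNReal.coe_one, one_mul, Real.dist_eq]
    calc |a * p.1.1 + b * p.1.2 - (a * q.1.1 + b * q.1.2)|
        = |a * (p.1.1 - q.1.1) + b * (p.1.2 - q.1.2)| := by congr 1; ring
      _ ≤ |a * (p.1.1 - q.1.1)| + |b * (p.1.2 - q.1.2)| := abs_add_le _ _
      _ = |p.1.1 - q.1.1| + |p.1.2 - q.1.2| := by rw [abs_mul, abs_mul, ha, hb, one_mul, one_mul]
      _ ≤ _ := X.taxi_le_dist p q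
  obtain ⟨g, hg, hfg⟩ := hLip.extend_real
  refine ⟨fun x => (Set.projIcc _ _ hle (g x) : ℝ), fun x y => ?_, fun p => ?_, fun x => ?_⟩
  · have h1 := (LipschitzWith.projIcc hle).comp hg
    simpa [Subtype.dist_eq] using h1.dist_le_mul x y
  · have : g (X.S p) = a * p.1.1 + b * p.1.2 := by
      rw [← hfg ⟨p, rfl⟩, hf]
    simp only [this]
    rw [Set.projIcc_of_mem hle (hbd p)]
  · exact Subtype.mem _

theorem signed_le_pathDist (X : SquaMS.{u}) (a b : ℝ) (ha : |a| = 1) (hb : |b| = 1) (n m : N)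
    (p q : M0) :
    |a * ((pos n p).1 - (pos m q).1) + b * ((pos n p).2 - (pos m q).2)| / 3 ≤
      pathDist X (n, X.S p) (m, X.S q) := by
  obtain ⟨g, hg, hgS, hgb⟩ := exists_short X a b ha hb
  let F : N × X.carrier → ℝ := fun c => (a * c.1.1.val + b * c.1.2.val + g c.2) / 3
  have hFS : ∀ n p, F (n, X.S p) = (a * (pos n p).1 + b * (pos n p).2) / 3 := by
    intro n p
    simp only [F, hgS, pos]
    ring
  have hrange : ∀ c, F c ∈ Set.Icc (min a 0 + min b 0) (max a 0 + max b 0) := by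
    rintro ⟨⟨i, j⟩, x⟩
    have hi : (i.val : ℝ) ≤ 2 := by exact_mod_cast Nat.le_of_lt_succ i.2
    have hj : (j.val : ℝ) ≤ 2 := by exact_mod_cast Nat.le_of_lt_succ j.2
    have hi' : (0 : ℝ) ≤ i.val := Nat.cast_nonneg _
    have hj' : (0 : ℝ) ≤ j.val := Nat.cast_nonneg _
    have := hgb x
    simp only [F]
    rcases eq_or_eq_neg_of_abs_eq ha with rfl | rfl <;>
      rcases eq_or_eq_neg_of_abs_eq hb with rfl | rfl <;>
      norm_num at this ⊢ <;> constructor <;> linarith [this.1, this.2]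
  have key := dist_le_pathDist (X := X) (F := F) ?_ ?_ ?_ (n, X.S p) (m, X.S q)
  · rw [hFS, hFS, Real.dist_eq] at key
    refine le_trans (le_of_eq ?_) key
    rw [← abs_of_pos (show (0 : ℝ) < 3 by norm_num), ← abs_div,
      abs_of_pos (show (0 : ℝ) < 3 by norm_num)]
    congr 1
    ring
  · rintro ⟨n, _⟩ ⟨m, _⟩ ⟨p, q, h, rfl, rfl⟩
    rw [hFS, hFS, pos_eq_of_glue h]
  · intro n x y
    have := hg x y
    rw [Real.dist_eq] at this ⊢
    simp only [F]
    rw [← sub_div, abs_div, abs_of_pos (show (0 : ℝ) < 3 by norm_num), add_sub_add_left_eq_sub]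
    exact div_le_div_of_nonneg_right this (by norm_num)
  · intro c d
    refine (Real.dist_le_of_mem_Icc (hrange c) (hrange d)).trans ?_
    rcases eq_or_eq_neg_of_abs_eq ha with rfl | rfl <;>
      rcases eq_or_eq_neg_of_abs_eq hb with rfl | rfl <;> norm_num

theorem taxi_le_pathDist (n m : N) (p q : M0) :
    (|(pos n p).1 - (pos m q).1| + |(pos n p).2 - (pos m q).2|) / 3 ≤
      pathDist X (n, X.S p) (m, X.S q) := by
  have h1 : |(1 : ℝ)| = 1 := abs_one
  have h2 : |(-1 : ℝ)| = 1 := by simp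
  set s := (pos n p).1 - (pos m q).1 with hs
  set t := (pos n p).2 - (pos m q).2 with ht
  have e1 := (div_le_iff₀ (show (0 : ℝ) < 3 by norm_num)).1 (signed_le_pathDist X 1 1 h1 h1 n m p q)
  have e2 := (div_le_iff₀ (show (0 : ℝ) < 3 by norm_num)).1
    (signed_le_pathDist X 1 (-1) h1 h2 n m p q)
  rw [← hs, ← ht] at e1 e2
  rw [div_le_iff₀ (by norm_num : (0 : ℝ) < 3)]
  have e1' := abs_le.1 e1
  have e2' := abs_le.1 e2
  rcases abs_cases s with ⟨hs', _⟩ | ⟨hs', _⟩ <;> rcases abs_cases t with ⟨ht', _⟩ | ⟨ht', _⟩ <;>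
    rw [hs', ht'] <;> linarith [e1'.1, e1'.2, e2'.1, e2'.2]

/-- The boundary of a square metric space is closed. -/
theorem isClosed_range_S (X : SquaMS.{u}) : IsClosed (Set.range X.S) := by
  have key : ∀ e : unitInterval → M0,
      (∀ s t, dist (X.S (e s)) (X.S (e t)) = |(t : ℝ) - s|) →
      IsClosed (Set.range fun t => X.S (e t)) := by
    intro e he
    have : Isometry fun t => X.S (e t) := Isometry.of_dist_eq fun s t => by
      rw [he, Subtype.dist_eq, Real.dist_eq, abs_sub_comm]
    exact (isCompact_range this.continuous).isClosed
  let e1 : unitInterval → M0 := fun t => ⟨(0, t), Or.inl ⟨Or.inl rfl, t.2⟩⟩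
  let e2 : unitInterval → M0 := fun t => ⟨(1, t), Or.inl ⟨Or.inr rfl, t.2⟩⟩
  let e3 : unitInterval → M0 := fun t => ⟨(t, 0), Or.inr ⟨t.2, Or.inl rfl⟩⟩
  let e4 : unitInterval → M0 := fun t => ⟨(t, 1), Or.inr ⟨t.2, Or.inr rfl⟩⟩
  have k1 := key e1 fun s t => X.dist_vertical _ _ rfl (Or.inl rfl)
  have k2 := key e2 fun s t => X.dist_vertical _ _ rfl (Or.inr rfl)
  have k3 := key e3 fun s t => X.dist_horizontal _ _ rfl (Or.inl rfl)
  have k4 := key e4 fun s t => X.dist_horizontal _ _ rfl (Or.inr rfl)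
  convert (k1.union k2).union (k3.union k4) using 1
  apply Set.Subset.antisymm
  · rintro _ ⟨⟨⟨x, y⟩, (⟨h | h, h'⟩ | ⟨h, h' | h'⟩)⟩, rfl⟩
    · exact Or.inl (Or.inl ⟨⟨y, h'⟩, congrArg X.S (Subtype.ext (Prod.ext h.symm rfl))⟩)
    · exact Or.inl (Or.inr ⟨⟨y, h'⟩, congrArg X.S (Subtype.ext (Prod.ext h.symm rfl))⟩)
    · exact Or.inr (Or.inl ⟨⟨x, h⟩, congrArg X.S (Subtype.ext (Prod.ext rfl h'.symm))⟩)
    · exact Or.inr (Or.inr ⟨⟨x, h⟩, congrArg X.S (Subtype.ext (Prod.ext rfl h'.symm))⟩)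
  · rintro _ ((⟨t, rfl⟩ | ⟨t, rfl⟩) | (⟨t, rfl⟩ | ⟨t, rfl⟩)) <;> exact ⟨_, rfl⟩

/-- A point of a cell that is not on its boundary has positive distance to all other points. -/
theorem eq_of_pathDist_eq_zero_of_interior {n m : N} {x y : X.carrier}
    (hx : x ∉ Set.range X.S) (h : pathDist X (n, x) (m, y) = 0) :
    (n, x) = (m, y) := by
  have hne : (Set.range X.S).Nonempty := ⟨_, ⟨⟨(0, 0), Or.inl ⟨Or.inl rfl, by simp⟩⟩, rfl⟩⟩
  set δ := Metric.infDist x (Set.range X.S) with hδ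
  have hpos : 0 < δ := ((isClosed_range_S X).notMem_iff_infDist_pos hne).1 hx
  have hδ2 : δ ≤ 2 := by
    obtain ⟨z, hz⟩ := hne
    exact (Metric.infDist_le_dist_of_mem hz).trans (X.dist_le_two _ _)
  have hSδ : ∀ p, δ ≤ dist x (X.S p) := fun p => Metric.infDist_le_dist_of_mem ⟨p, rfl⟩
  let F : N × X.carrier → ℝ := fun c => if n = c.1 then min (dist x c.2) δ / 3 else δ / 3
  have hFS : ∀ k p, F (k, X.S p) = δ / 3 := by
    intro k p
    simp only [F]
    rw [min_eq_right (hSδ p), ite_self]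
  have hrange : ∀ c, F c ∈ Set.Icc (0 : ℝ) (δ / 3) := by
    intro c
    simp only [F]
    split_ifs
    · exact ⟨by positivity, div_le_div_of_nonneg_right (min_le_right _ _) (by norm_num)⟩
    · exact ⟨by positivity, le_rfl⟩
  have key := dist_le_pathDist (X := X) (F := F) ?_ ?_ ?_ (n, x) (m, y)
  · rw [h] at key
    have hF := dist_le_zero.1 key
    have h0 : F (n, x) = 0 := by simp [F, hpos.le]
    rw [h0] at hF
    by_cases hnm : n = m
    · subst hnm
      simp only [F, if_true] at hF
      have h3 : min (dist x y) δ = 0 := by linarith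
      rcases min_choice (dist x y) δ with h4 | h4
      · rw [h4] at h3
        rw [dist_eq_zero.1 h3]
      · rw [h4] at h3
        exact absurd h3 hpos.ne'
    · simp only [F, if_neg hnm] at hF
      linarith
  · rintro ⟨n, _⟩ ⟨m, _⟩ ⟨p, q, h, rfl, rfl⟩
    exact (hFS n p).trans (hFS m q).symm
  · intro k u v
    simp only [F]
    split_ifs
    · rw [Real.dist_eq, ← sub_div, abs_div, abs_of_pos (show (0 : ℝ) < 3 by norm_num)]
      refine div_le_div_of_nonneg_right ?_ (by norm_num)
      refine (abs_min_sub_min_le_max _ _ _ _).trans ?_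
      rw [sub_self, abs_zero]
      refine max_le ?_ dist_nonneg
      rw [dist_comm x u, dist_comm x v]
      exact abs_dist_sub_le u v x
    · rw [dist_self]
      positivity
  · intro c d
    refine (Real.dist_le_of_mem_Icc (hrange c) (hrange d)).trans ?_
    linarith

theorem tmk_eq_of_pathDist_eq_zero {n m : N} {x y : X.carrier}
    (h : pathDist X (n, x) (m, y) = 0) : tmk n x = tmk m y := by
  by_cases hx : x ∈ Set.range X.S
  · by_cases hy : y ∈ Set.range X.S
    · obtain ⟨p, rfl⟩ := hx
      obtain ⟨q, rfl⟩ := hy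
      have h1 := taxi_le_pathDist (X := X) n m p q
      rw [h] at h1
      have h2 := abs_nonneg ((pos n p).1 - (pos m q).1)
      have h3 := abs_nonneg ((pos n p).2 - (pos m q).2)
      apply tmk_eq_of_pos_eq
      ext
      · exact sub_eq_zero.1 (abs_eq_zero.1 (by linarith))
      · exact sub_eq_zero.1 (abs_eq_zero.1 (by linarith))
    · rw [pathDist_comm] at h
      exact congrArg (Quotient.mk (glueSetoid X)) (eq_of_pathDist_eq_zero_of_interior hy h).symm
  · exact congrArg (Quotient.mk (glueSetoid X)) (eq_of_pathDist_eq_zero_of_interior hx h)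

/-- The quotient metric on `N ⊗ X`. -/
noncomputable instance : MetricSpace (Tensor X) where
  dist := Quotient.lift₂ (pathDist X) fun _ _ _ _ h h' => pathDist_congr h h'
  dist_self := by
    rintro ⟨a⟩
    exact pathDist_of_rel ((glueSetoid X).refl a)
  dist_comm := by
    rintro ⟨a⟩ ⟨b⟩
    exact pathDist_comm a b
  dist_triangle := by
    rintro ⟨a⟩ ⟨b⟩ ⟨c⟩
    exact pathDist_triangle a b c
  eq_of_dist_eq_zero := by
    rintro ⟨⟨n, x⟩⟩ ⟨⟨m, y⟩⟩ h
    exact tmk_eq_of_pathDist_eq_zero h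

theorem dist_tmk (n m : N) (x y : X.carrier) :
    dist (tmk n x) (tmk m y) = pathDist X (n, x) (m, y) := rfl

theorem dist_tmk_same_le (n : N) (x y : X.carrier) :
    dist (tmk n x) (tmk n y) ≤ dist x y / 3 := by
  rw [dist_tmk]
  refine (pathDist_le_step _ _).trans ((step_le_cellDist X _ _).trans ?_)
  simp [cellDist]

/-! ### The square metric space `N ⊗ X` -/

/-- The index of the third of `[0,1]` that contains `t`. -/
noncomputable def third (t : ℝ) : Fin 3 := if t ≤ 1 / 3 then 0 else if t ≤ 2 / 3 then 1 else 2

theorem third_zero : third 0 = 0 := by simp [third]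

theorem third_one : third 1 = 2 := by norm_num [third]

theorem third_mem {t : ℝ} (ht : t ∈ Set.Icc (0 : ℝ) 1) :
    3 * t - (third t).val ∈ Set.Icc (0 : ℝ) 1 := by
  have h1 := ht.1
  have h2 := ht.2
  unfold third
  split_ifs <;> constructor <;> norm_num <;> linarith

theorem third_boundary {t : ℝ} (ht : t = 0 ∨ t = 1) :
    3 * t - (third t).val = 0 ∨ 3 * t - (third t).val = 1 := by
  rcases ht with rfl | rfl
  · left; simp [third_zero]
  · right; rw [third_one]; norm_num

/-- The position inside its cell of a boundary point of the large square. -/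
noncomputable def zoom (p : M0) : M0 :=
  ⟨(3 * p.1.1 - (third p.1.1).val, 3 * p.1.2 - (third p.1.2).val), by
    obtain ⟨p, (⟨h, h'⟩ | ⟨h, h'⟩)⟩ := p
    · exact Or.inl ⟨third_boundary h, third_mem h'⟩
    · exact Or.inr ⟨third_mem h, third_boundary h'⟩⟩

/-- The boundary map of `N ⊗ X`: the boundary point `(r, s)` goes to
`(i, j) ⊗ S (3 r - i, 3 s - j)`, where `(i, j)` is a cell that contains `(r, s)`. (If several cells
contain `(r, s)`, all of them give the same element, see `tensorS_eq`.) -/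
noncomputable def tensorS (X : SquaMS.{u}) (p : M0) : Tensor X :=
  tmk (third p.1.1, third p.1.2) (X.S (zoom p))

theorem pos_zoom (p : M0) :
    pos (third p.1.1, third p.1.2) (zoom p) = (3 * p.1.1, 3 * p.1.2) := by
  simp [pos, zoom]

theorem tensorS_eq (n : N) (p q : M0) (h1 : (n.1.val : ℝ) + q.1.1 = 3 * p.1.1)
    (h2 : (n.2.val : ℝ) + q.1.2 = 3 * p.1.2) : tensorS X p = tmk n (X.S q) := by
  apply tmk_eq_of_pos_eq
  rw [pos_zoom]
  exact Prod.ext h1.symm h2.symm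

theorem taxi_le_dist_tensorS (p q : M0) :
    |p.1.1 - q.1.1| + |p.1.2 - q.1.2| ≤ dist (tensorS X p) (tensorS X q) := by
  have := taxi_le_pathDist (X := X) (third p.1.1, third p.1.2) (third q.1.1, third q.1.2)
    (zoom p) (zoom q)
  rw [pos_zoom, pos_zoom] at this
  simp only [← mul_sub, abs_mul] at this
  rw [abs_of_pos (show (0 : ℝ) < 3 by norm_num), ← mul_add, mul_div_cancel_left₀ _ (by norm_num)]
    at this
  exact this

/-- A map on the unit interval that is short on each third is short. -/
theorem short_of_thirds {Y : Type*} [PseudoMetricSpace Y] (f : ℝ → Y)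
    (h : ∀ (i : Fin 3) (a b : ℝ), 3 * a - i.val ∈ Set.Icc (0 : ℝ) 1 →
      3 * b - i.val ∈ Set.Icc (0 : ℝ) 1 → dist (f a) (f b) ≤ |b - a|)
    (a b : ℝ) (ha : a ∈ Set.Icc (0 : ℝ) 1) (hb : b ∈ Set.Icc (0 : ℝ) 1) :
    dist (f a) (f b) ≤ |b - a| := by
  wlog hab : a ≤ b generalizing a b
  · rw [dist_comm, abs_sub_comm]
    exact this b a hb ha (le_of_not_ge hab)
  rw [abs_of_nonneg (sub_nonneg.2 hab)]
  have H : ∀ (i : Fin 3) (a b : ℝ), a ≤ b → 3 * a - i.val ∈ Set.Icc (0 : ℝ) 1 →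
      3 * b - i.val ∈ Set.Icc (0 : ℝ) 1 → dist (f a) (f b) ≤ b - a := by
    intro i a b hab h1 h2
    have := h i a b h1 h2
    rwa [abs_of_nonneg (sub_nonneg.2 hab)] at this
  obtain ⟨ha0, ha1⟩ := ha
  obtain ⟨hb0, hb1⟩ := hb
  have H0 := fun a b (hab : a ≤ b) (h1 : 0 ≤ a) (h2 : b ≤ 1 / 3) =>
    H 0 a b hab (by norm_num; constructor <;> linarith) (by norm_num; constructor <;> linarith)
  have H1 := fun a b (hab : a ≤ b) (h1 : 1 / 3 ≤ a) (h2 : b ≤ 2 / 3) =>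
    H 1 a b hab (by norm_num; constructor <;> linarith) (by norm_num; constructor <;> linarith)
  have H2 := fun a b (hab : a ≤ b) (h1 : 2 / 3 ≤ a) (h2 : b ≤ 1) =>
    H 2 a b hab (by norm_num; constructor <;> linarith) (by norm_num; constructor <;> linarith)
  have T1 := dist_triangle (f a) (f (1 / 3)) (f b)
  have T2 := dist_triangle (f a) (f (2 / 3)) (f b)
  have T3 := dist_triangle (f a) (f (1 / 3)) (f (2 / 3))
  rcases le_total a (1 / 3) with h1 | h1
  · rcases le_total b (1 / 3) with h2 | h2
    · exact H0 a b hab ha0 h2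
    · have := H0 a (1 / 3) h1 ha0 le_rfl
      rcases le_total b (2 / 3) with h3 | h3
      · have := H1 (1 / 3) b h2 le_rfl h3
        linarith
      · have := H1 (1 / 3) (2 / 3) (by norm_num) le_rfl le_rfl
        have := H2 (2 / 3) b h3 le_rfl hb1
        linarith
  · rcases le_total a (2 / 3) with h2 | h2
    · rcases le_total b (2 / 3) with h3 | h3
      · exact H1 a b hab h1 h3
      · have := H1 a (2 / 3) h2 h1 le_rfl
        have := H2 (2 / 3) b h3 le_rfl hb1
        linarith
    · exact H2 a b hab h2 hb1

/-- A side of the large square is short, because it consists of three sides of cells. -/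
theorem side_short (X : SquaMS.{u}) (e : ℝ → M0) (j : Fin 3 → N)
    (hj : ∀ (i : Fin 3) (t : ℝ), 3 * t - i.val ∈ Set.Icc (0 : ℝ) 1 →
      tensorS X (e t) = tmk (j i) (X.S (e (3 * t - i.val))))
    (he : ∀ s ∈ Set.Icc (0 : ℝ) 1, ∀ t ∈ Set.Icc (0 : ℝ) 1,
      dist (X.S (e s)) (X.S (e t)) = |t - s|)
    (a b : ℝ) (ha : a ∈ Set.Icc (0 : ℝ) 1) (hb : b ∈ Set.Icc (0 : ℝ) 1) :
    dist (tensorS X (e a)) (tensorS X (e b)) ≤ |b - a| := by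
  refine short_of_thirds (fun t => tensorS X (e t)) (fun i a b ha hb => ?_) a b ha hb
  simp only [hj i a ha, hj i b hb]
  refine (dist_tmk_same_le _ _ _).trans ?_
  rw [he _ ha _ hb, sub_sub_sub_cancel_right, ← mul_sub, abs_mul,
    abs_of_pos (show (0 : ℝ) < 3 by norm_num), mul_div_cancel_left₀ _ (by norm_num)]

/-- The point of the unit interval closest to `t`. -/
noncomputable def clamp (t : ℝ) : unitInterval := Set.projIcc 0 1 zero_le_one t

theorem clamp_of_mem {t : ℝ} (ht : t ∈ Set.Icc (0 : ℝ) 1) : (clamp t : ℝ) = t := by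
  rw [clamp, Set.projIcc_of_mem _ ht]

theorem mem_of_third {t : ℝ} {i : Fin 3} (h : 3 * t - i.val ∈ Set.Icc (0 : ℝ) 1) :
    t ∈ Set.Icc (0 : ℝ) 1 := by
  have hi : (i.val : ℝ) ≤ 2 := by exact_mod_cast Nat.le_of_lt_succ i.2
  have hi' : (0 : ℝ) ≤ i.val := Nat.cast_nonneg _
  constructor <;> linarith [h.1, h.2]

theorem third_add_self {c : ℝ} (hc : c = 0 ∨ c = 1) : ((third c).val : ℝ) + c = 3 * c := by
  rcases hc with rfl | rfl
  · simp [third_zero]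
  · rw [third_one]; norm_num

theorem dist_tensorS_vertical (p q : M0) (h : p.1.1 = q.1.1) (h' : p.1.1 = 0 ∨ p.1.1 = 1) :
    dist (tensorS X p) (tensorS X q) = |q.1.2 - p.1.2| := by
  apply le_antisymm
  · let e : ℝ → M0 := fun t => ⟨(p.1.1, clamp t), Or.inl ⟨h', (clamp t).2⟩⟩
    have hp : e p.1.2 = p := Subtype.ext (Prod.ext rfl (clamp_of_mem p.snd_mem))
    have hq : e q.1.2 = q := Subtype.ext (Prod.ext h (clamp_of_mem q.snd_mem))
    have := side_short X e (fun i => (third p.1.1, i)) ?_ ?_ p.1.2 q.1.2 p.snd_mem q.snd_mem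
    · rwa [hp, hq] at this
    · intro i t ht
      refine tensorS_eq _ _ _ (third_add_self h') ?_
      simp only [e]
      rw [clamp_of_mem ht, clamp_of_mem (mem_of_third ht)]
      ring
    · intro s hs t ht
      rw [X.dist_vertical (e s) (e t) rfl h']
      simp only [e]
      rw [clamp_of_mem hs, clamp_of_mem ht]
  · have := taxi_le_dist_tensorS (X := X) p q
    rw [abs_sub_comm]
    exact (le_add_of_nonneg_left (abs_nonneg _)).trans this

theorem dist_tensorS_horizontal (p q : M0) (h : p.1.2 = q.1.2) (h' : p.1.2 = 0 ∨ p.1.2 = 1) :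
    dist (tensorS X p) (tensorS X q) = |q.1.1 - p.1.1| := by
  apply le_antisymm
  · let e : ℝ → M0 := fun t => ⟨(clamp t, p.1.2), Or.inr ⟨(clamp t).2, h'⟩⟩
    have hp : e p.1.1 = p := Subtype.ext (Prod.ext (clamp_of_mem p.fst_mem) rfl)
    have hq : e q.1.1 = q := Subtype.ext (Prod.ext (clamp_of_mem q.fst_mem) h)
    have := side_short X e (fun i => (i, third p.1.2)) ?_ ?_ p.1.1 q.1.1 p.fst_mem q.fst_mem
    · rwa [hp, hq] at this
    · intro i t ht
      refine tensorS_eq _ _ _ ?_ (third_add_self h')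
      simp only [e]
      rw [clamp_of_mem ht, clamp_of_mem (mem_of_third ht)]
      ring
    · intro s hs t ht
      rw [X.dist_horizontal (e s) (e t) rfl h']
      simp only [e]
      rw [clamp_of_mem hs, clamp_of_mem ht]
  · have := taxi_le_dist_tensorS (X := X) p q
    rw [abs_sub_comm]
    exact (le_add_of_nonneg_right (abs_nonneg _)).trans this

theorem injective_of_taxi_le {Y : Type*} [PseudoMetricSpace Y] (S : M0 → Y)
    (h : ∀ p q : M0, |p.1.1 - q.1.1| + |p.1.2 - q.1.2| ≤ dist (S p) (S q)) :
    Function.Injective S := by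
  intro p q hpq
  have h1 := h p q
  rw [hpq, dist_self] at h1
  have h2 := abs_nonneg (p.1.1 - q.1.1)
  have h3 := abs_nonneg (p.1.2 - q.1.2)
  apply Subtype.ext
  apply Prod.ext
  · exact sub_eq_zero.1 (abs_eq_zero.1 (by linarith))
  · exact sub_eq_zero.1 (abs_eq_zero.1 (by linarith))

/-- The square metric space `N ⊗ X`. -/
noncomputable def tensor (X : SquaMS.{u}) : SquaMS.{u} where
  carrier := Tensor X
  S := tensorS X
  S_injective := injective_of_taxi_le _ taxi_le_dist_tensorS
  dist_le_two := by
    rintro ⟨a⟩ ⟨b⟩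
    exact pathDist_le_two a b
  dist_vertical := dist_tensorS_vertical
  dist_horizontal := dist_tensorS_horizontal
  taxi_le_dist := taxi_le_dist_tensorS

/-! ### The functor `N ⊗ -` -/

/-- To define a short map on `N ⊗ X`, give a map on `N × X` that respects the identifications, is
`1/3`-Lipschitz on each copy and has an image of diameter at most `2`. -/
theorem lift_short {β : Type*} [PseudoMetricSpace β] {F : N × X.carrier → β}
    (hF : ∀ a b, Glue X a b → F a = F b)
    (hcell : ∀ n x y, dist (F (n, x)) (F (n, y)) ≤ dist x y / 3)
    (hbdd : ∀ a b, dist (F a) (F b) ≤ 2) (a b : Tensor X) :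
    dist (Quotient.lift F (fun _ _ h => eq_of_rel hF h) a : β)
      (Quotient.lift F (fun _ _ h => eq_of_rel hF h) b) ≤ dist a b := by
  induction a using Quotient.inductionOn
  induction b using Quotient.inductionOn
  exact dist_le_pathDist hF hcell hbdd _ _

variable {Y} in
theorem tensorMap_respects (f : X ⟶ Y) (a b : N × X.carrier) (h : Glue X a b) :
    tmk a.1 (f.toFun a.2) = tmk b.1 (f.toFun b.2) := by
  obtain ⟨n, _⟩ := a
  obtain ⟨m, _⟩ := b
  obtain ⟨p, q, h, rfl, rfl⟩ := h
  simp only [f.map_S]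
  exact tmk_eq_of_glue h

variable {Y} in
/-- The morphism `N ⊗ f`, that takes `n ⊗ x` to `n ⊗ f x`. -/
noncomputable def tensorMap (f : X ⟶ Y) : tensor X ⟶ tensor Y where
  toFun := Quotient.lift (fun a : N × X.carrier => tmk a.1 (f.toFun a.2))
    fun _ _ h => eq_of_rel (tensorMap_respects f) h
  short := lift_short (tensorMap_respects f)
    (fun n x y => (dist_tmk_same_le n _ _).trans
      (div_le_div_of_nonneg_right (f.short x y) (by norm_num)))
    (fun a b => (tensor Y).dist_le_two _ _)
  map_S := fun p => congrArg (tmk (third p.1.1, third p.1.2)) (f.map_S (zoom p))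

/-- The functor `N ⊗ -` on square metric spaces. -/
noncomputable def nTensor : SquaMS.{u} ⥤ SquaMS.{u} where
  obj X := tensor X
  map f := tensorMap f
  map_id _ := SquaMS.Hom.ext (funext fun a => Quotient.inductionOn a fun _ => rfl)
  map_comp _ _ := SquaMS.Hom.ext (funext fun a => Quotient.inductionOn a fun _ => rfl)

/-! ### The Cauchy completion functor -/

open UniformSpace in
/-- The Cauchy completion of a square metric space. -/
noncomputable def completion (X : SquaMS.{u}) : SquaMS.{u} where
  carrier := Completion X.carrier
  S p := (X.S p : Completion X.carrier)
  S_injective := injective_of_taxi_le _ fun p q => by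
    rw [Completion.dist_eq]
    exact X.taxi_le_dist p q
  dist_le_two x y := by
    induction x, y using Completion.induction_on₂ with
    | hp => exact isClosed_le continuous_dist continuous_const
    | ih x y =>
      rw [Completion.dist_eq]
      exact X.dist_le_two x y
  dist_vertical p q h h' := by
    rw [Completion.dist_eq]
    exact X.dist_vertical p q h h'
  dist_horizontal p q h h' := by
    rw [Completion.dist_eq]
    exact X.dist_horizontal p q h h'
  taxi_le_dist p q := by
    rw [Completion.dist_eq]
    exact X.taxi_le_dist p q

variable {Y} in
theorem SquaMS.Hom.lipschitz (f : X ⟶ Y) : LipschitzWith 1 f.toFun :=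
  LipschitzWith.of_dist_le_mul fun x y => by simpa using f.short x y

open UniformSpace in
/-- The Cauchy completion functor on square metric spaces; `C(f)` is the continuous extension
of `f`. -/
noncomputable def completionFunctor : SquaMS.{u} ⥤ SquaMS.{u} where
  obj X := completion X
  map {X Y} f :=
    { toFun := Completion.map f.toFun
      short := fun x y =>
        ((SquaMS.Hom.lipschitz f).completion_map.dist_le_mul x y).trans
          (one_mul (dist x y)).le
      map_S := fun p => by
        refine (Completion.map_coe (SquaMS.Hom.lipschitz f).uniformContinuous _).trans ?_
        rw [f.map_S]
        rfl }
  map_id X := SquaMS.Hom.ext Completion.map_id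
  map_comp f g := SquaMS.Hom.ext (Completion.map_comp
    (SquaMS.Hom.lipschitz g).uniformContinuous (SquaMS.Hom.lipschitz f).uniformContinuous).symm

/-! ### The comparison `N ⊗ C X ⟶ C (N ⊗ X)` -/

theorem tmk_lipschitz (n : N) : LipschitzWith (1 / 3) (tmk (X := X) n) :=
  LipschitzWith.of_dist_le_mul fun x y => by
    exact (dist_tmk_same_le n x y).trans (le_of_eq (one_div_mul_eq_div (3 : ℝ) _).symm)

open UniformSpace in
/-- The map `N × C X → C (N ⊗ X)` that takes `(n, lim xₖ)` to `lim (n ⊗ xₖ)`. -/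
noncomputable def comparisonFun (X : SquaMS.{u}) (a : N × (completion X).carrier) :
    Completion (Tensor X) :=
  Completion.map (tmk (X := X) a.1) a.2

open UniformSpace in
theorem comparisonFun_coe (n : N) (x : X.carrier) :
    comparisonFun X (n, (x : Completion X.carrier)) = (tmk n x : Completion (Tensor X)) :=
  Completion.map_coe (tmk_lipschitz n).uniformContinuous x

theorem comparisonFun_respects (a b : N × (completion X).carrier) (h : Glue (completion X) a b) :
    comparisonFun X a = comparisonFun X b := by
  obtain ⟨n, _⟩ := a
  obtain ⟨m, _⟩ := b
  obtain ⟨p, q, h, rfl, rfl⟩ := h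
  refine (comparisonFun_coe n (X.S p)).trans
    (Eq.trans ?_ (comparisonFun_coe m (X.S q)).symm)
  rw [tmk_eq_of_glue h]

/-- The morphism `N ⊗ C X ⟶ C (N ⊗ X)` that takes `n ⊗ lim xₖ` to `lim (n ⊗ xₖ)`. -/
noncomputable def comparison (X : SquaMS.{u}) :
    nTensor.obj (completionFunctor.obj X) ⟶ completionFunctor.obj (nTensor.obj X) where
  toFun := Quotient.lift (comparisonFun X) fun _ _ h => eq_of_rel comparisonFun_respects h
  short := lift_short comparisonFun_respects
    (fun n x y => ((tmk_lipschitz n).completion_map.dist_le_mul x y).trans (le_of_eq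
      (one_div_mul_eq_div (3 : ℝ) (dist x y))))
    (fun _ _ => (completion (tensor X)).dist_le_two _ _)
  map_S := fun _ => comparisonFun_coe _ _

/-- For an algebra `λ : N ⊗ W ⟶ W`, the induced algebra structure `θ = C(λ) ∘ i : N ⊗ V ⟶ V` on
the Cauchy completion `V = C W`, where `i : N ⊗ C W ⟶ C (N ⊗ W)` is the comparison morphism. -/
noncomputable def theta (A : Endofunctor.Algebra nTensor.{u}) :
    nTensor.obj (completionFunctor.obj A.a) ⟶ completionFunctor.obj A.a :=
  comparison A.a ≫ completionFunctor.map A.str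

/-! ### The unit square with the taxicab metric -/

/-- The unit square `[0,1]²` (in the universe `u`). -/
@[ext]
structure UnitSquare : Type u where
  fst : unitInterval
  snd : unitInterval

/-- The taxicab metric on the unit square. -/
noncomputable instance : MetricSpace UnitSquare.{u} where
  dist p q := |(p.fst : ℝ) - q.fst| + |(p.snd : ℝ) - q.snd|
  dist_self p := by simp
  dist_comm p q := by simp only [abs_sub_comm]
  dist_triangle p q r := by
    have h1 := abs_sub_le (p.fst : ℝ) q.fst r.fst
    have h2 := abs_sub_le (p.snd : ℝ) q.snd r.snd
    linarith
  eq_of_dist_eq_zero := by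
    intro p q h
    change |(p.fst : ℝ) - q.fst| + |(p.snd : ℝ) - q.snd| = 0 at h
    have h1 := abs_nonneg ((p.fst : ℝ) - q.fst)
    have h2 := abs_nonneg ((p.snd : ℝ) - q.snd)
    apply UnitSquare.ext
    · exact Subtype.ext (sub_eq_zero.1 (abs_eq_zero.1 (by linarith)))
    · exact Subtype.ext (sub_eq_zero.1 (abs_eq_zero.1 (by linarith)))

theorem UnitSquare.dist_def (p q : UnitSquare.{u}) :
    dist p q = |(p.fst : ℝ) - q.fst| + |(p.snd : ℝ) - q.snd| := rfl

/-- The square metric space `U₀`: the unit square with the taxicab metric and the inclusion of its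
boundary. -/
noncomputable def U0 : SquaMS.{u} where
  carrier := UnitSquare.{u}
  S p := ⟨⟨p.1.1, p.fst_mem⟩, ⟨p.1.2, p.snd_mem⟩⟩
  S_injective := injective_of_taxi_le _ fun p q => by rw [UnitSquare.dist_def]
  dist_le_two p q := by
    rw [UnitSquare.dist_def]
    have h1 : |(p.fst : ℝ) - q.fst| ≤ 1 := abs_sub_le_iff.2
      ⟨by linarith [p.fst.2.2, q.fst.2.1], by linarith [p.fst.2.1, q.fst.2.2]⟩
    have h2 : |(p.snd : ℝ) - q.snd| ≤ 1 := abs_sub_le_iff.2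
      ⟨by linarith [p.snd.2.2, q.snd.2.1], by linarith [p.snd.2.1, q.snd.2.2]⟩
    linarith
  dist_vertical p q h h' := by
    rw [UnitSquare.dist_def]
    simp [h, abs_sub_comm]
  dist_horizontal p q h h' := by
    rw [UnitSquare.dist_def]
    simp [h, abs_sub_comm]
  taxi_le_dist p q := by rw [UnitSquare.dist_def]

end SquareMetric

/-! The functor `N ⊗ -` shrinks distances inside a cell by the factor `1 / 3`, so for a coalgebra
`B` and a complete algebra `A` the coalgebra-to-algebra morphisms `B ⟶ A` are the fixed points of a
contraction of the complete space of morphisms `B ⟶ A`. By Banach's theorem a complete algebra with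
invertible structure map is a final coalgebra as soon as every square metric space has a morphism to
it. The unit square `U₀` is such an algebra: it is cut into nine copies of itself, and it receives
morphisms from all square metric spaces because the real-valued functions `r + s` and `r - s` on the
boundary extend without increasing distances.

The initial algebra consists of the points of `U₀` that have a triadic rational coordinate. A
morphism out of it is forced on the subdivided boundary of the square; it is short along each
triadic line by induction on the subdivision, hence short, because the taxicab distance is attained
by paths along such lines. The initial algebra is thus isometric to a dense subset of the complete
space `U₀`, and its completion is `U₀` as an algebra. -/

namespace SquareMetric

/-! ### Algebras with invertible structure map -/

section

variable {C : Type*} [Category* C] {F : C ⥤ C} {A A' : Endofunctor.Algebra F}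

/-- The coalgebra `(V, θ⁻¹)` of an algebra `(V, θ)` with invertible structure map. -/
noncomputable abbrev invCoalgebra (A : Endofunctor.Algebra F) [IsIso A.str] :
    Endofunctor.Coalgebra F where
  V := A.a
  str := inv A.str

theorem isIso_str_of_iso (e : A ≅ A') [IsIso A'.str] : IsIso A.str := by
  have : IsIso e.hom.f := ((Endofunctor.Algebra.forget F).mapIso e).isIso_hom
  have : IsIso (A.str ≫ e.hom.f) := e.hom.h ▸ inferInstance
  exact IsIso.of_isIso_comp_right A.str e.hom.f

/-- Functoriality of `invCoalgebra` in isomorphisms. -/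
noncomputable def invCoalgebraIso (e : A ≅ A') [IsIso A.str] [IsIso A'.str] :
    invCoalgebra A ≅ invCoalgebra A' :=
  Endofunctor.Coalgebra.isoMk ((Endofunctor.Algebra.forget F).mapIso e) <| by
    change inv A.str ≫ F.map e.hom.f = e.hom.f ≫ inv A'.str
    rw [IsIso.inv_comp_eq, ← Category.assoc, IsIso.eq_comp_inv, e.hom.h]

end

/-! ### Morphisms of square metric spaces -/

section

variable {X Y : SquaMS.{u}}

theorem SquaMS.Hom.congr_toFun {f g : X ⟶ Y} (h : f = g) (x : X.carrier) :
    f.toFun x = g.toFun x := h ▸ rfl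

theorem SquaMS.isIso_iff {f : X ⟶ Y} :
    IsIso f ↔ Isometry f.toFun ∧ Function.Surjective f.toFun := by
  constructor
  · intro hf
    have hleft : ∀ x, (inv f).toFun (f.toFun x) = x :=
      SquaMS.Hom.congr_toFun (IsIso.hom_inv_id f)
    have hright : ∀ y, f.toFun ((inv f).toFun y) = y :=
      SquaMS.Hom.congr_toFun (IsIso.inv_hom_id f)
    refine ⟨Isometry.of_dist_eq fun x y => le_antisymm (f.short x y) ?_, fun y => ⟨_, hright y⟩⟩
    simpa only [hleft] using (inv f).short (f.toFun x) (f.toFun y)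
  · rintro ⟨hf, hsurj⟩
    let e := Equiv.ofBijective f.toFun ⟨hf.injective, hsurj⟩
    have he : ∀ y, f.toFun (e.symm y) = y := e.apply_symm_apply
    refine ⟨⟨e.symm, fun x y => ?_, fun p => ?_⟩, ?_, ?_⟩
    · rw [← hf.dist_eq, he, he]
    · rw [← f.map_S p]
      exact e.symm_apply_apply _
    · exact SquaMS.Hom.ext (funext e.symm_apply_apply)
    · exact SquaMS.Hom.ext (funext he)

/-- The morphism `N ⊗ X ⟶ Y` induced by a map on `N × X`. -/
noncomputable def tensorDesc (F : N × X.carrier → Y.carrier)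
    (hglue : ∀ n m p q, GridGlue (n, p) (m, q) → F (n, X.S p) = F (m, X.S q))
    (hcell : ∀ n x y, dist (F (n, x)) (F (n, y)) ≤ dist x y / 3)
    (hS : ∀ p, F ((third p.1.1, third p.1.2), X.S (zoom p)) = Y.S p) : tensor X ⟶ Y :=
  have hF : ∀ a b, Glue X a b → F a = F b := by
    rintro ⟨n, _⟩ ⟨m, _⟩ ⟨p, q, h, rfl, rfl⟩
    exact hglue n m p q h
  { toFun := Quotient.lift F fun _ _ h => eq_of_rel hF h
    short := lift_short hF hcell fun _ _ => Y.dist_le_two _ _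
    map_S := hS }

theorem tensor_hom_ext {f g : tensor X ⟶ Y}
    (h : ∀ n x, f.toFun (tmk n x) = g.toFun (tmk n x)) : f = g :=
  SquaMS.Hom.ext (funext fun a => Quotient.inductionOn a fun b => h b.1 b.2)

theorem dist_toFun_tmk_le (f : tensor X ⟶ Y) (n : N) (x y : X.carrier) :
    dist (f.toFun (tmk n x)) (f.toFun (tmk n y)) ≤ dist x y / 3 :=
  (f.short _ _).trans (dist_tmk_same_le n x y)

end

/-! ### Corecursion in complete algebras -/

section

open scoped BoundedContinuousFunction

variable {B Y : SquaMS.{u}}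

/-- A morphism as a bounded continuous function; used to equip `B ⟶ Y` with the supremum
distance. -/
noncomputable def SquaMS.Hom.toBoundedContinuousFunction (f : B ⟶ Y) : B.carrier →ᵇ Y.carrier :=
  .mkOfBound ⟨f.toFun, (SquaMS.Hom.lipschitz f).continuous⟩ 2 fun _ _ => Y.dist_le_two _ _

/-- The supremum distance on the morphisms `B ⟶ Y`. -/
noncomputable instance : MetricSpace (B ⟶ Y) :=
  MetricSpace.induced SquaMS.Hom.toBoundedContinuousFunction
    (fun _ _ h => SquaMS.Hom.ext (congrArg DFunLike.coe h)) inferInstance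

theorem SquaMS.Hom.dist_le {f g : B ⟶ Y} {c : ℝ} (hc : 0 ≤ c) :
    dist f g ≤ c ↔ ∀ x, dist (f.toFun x) (g.toFun x) ≤ c :=
  BoundedContinuousFunction.dist_le hc

theorem SquaMS.Hom.dist_apply_le (f g : B ⟶ Y) (x : B.carrier) :
    dist (f.toFun x) (g.toFun x) ≤ dist f g :=
  (SquaMS.Hom.dist_le dist_nonneg).1 le_rfl x

theorem SquaMS.Hom.range_toBoundedContinuousFunction :
    Set.range (toBoundedContinuousFunction (B := B) (Y := Y)) =
      {F | (∀ x y, dist (F x) (F y) ≤ dist x y) ∧ ∀ p, F (B.S p) = Y.S p} := by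
  ext F
  constructor
  · rintro ⟨f, rfl⟩
    exact ⟨f.short, f.map_S⟩
  · rintro ⟨hshort, hS⟩
    exact ⟨⟨F, hshort, hS⟩, rfl⟩

instance [CompleteSpace Y.carrier] : CompleteSpace (B ⟶ Y) := by
  have hisom : Isometry (SquaMS.Hom.toBoundedContinuousFunction (B := B) (Y := Y)) :=
    Isometry.of_dist_eq fun _ _ => rfl
  rw [completeSpace_iff_isComplete_range hisom.isUniformInducing,
    SquaMS.Hom.range_toBoundedContinuousFunction]
  simp only [Set.ofPred_and, Set.ofPred_forall]
  refine ((isClosed_iInter fun x => isClosed_iInter fun y => ?_).inter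
    (isClosed_iInter fun p => ?_)).isComplete
  · exact isClosed_le (by fun_prop) continuous_const
  · exact isClosed_eq (by fun_prop) continuous_const

/-- The operator whose fixed points are the coalgebra-to-algebra morphisms from `(B, β)` to
`(Y, ν)`. -/
noncomputable def corecStep (β : B ⟶ tensor B) (ν : tensor Y ⟶ Y) (f : B ⟶ Y) : B ⟶ Y :=
  β ≫ nTensor.map f ≫ ν

theorem contractingWith_corecStep (β : B ⟶ tensor B) (ν : tensor Y ⟶ Y) :
    ContractingWith (1 / 3) (corecStep β ν) := by
  refine ⟨by norm_num [← NNReal.coe_lt_coe], LipschitzWith.of_dist_le_mul fun f g => ?_⟩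
  refine (SquaMS.Hom.dist_le (by positivity)).2 fun x => ?_
  have hcell : ∀ a : Tensor B, dist (ν.toFun ((nTensor.map f).toFun a))
      (ν.toFun ((nTensor.map g).toFun a)) ≤ dist f g / 3 := by
    rintro ⟨n, y⟩
    refine (dist_toFun_tmk_le ν n _ _).trans ?_
    gcongr
    exact SquaMS.Hom.dist_apply_le f g y
  exact (hcell _).trans_eq (one_div_mul_eq_div (3 : ℝ) _).symm

theorem existsUnique_corecStep_eq [CompleteSpace Y.carrier] [Nonempty (B ⟶ Y)]
    (β : B ⟶ tensor B) (ν : tensor Y ⟶ Y) : ∃! f, corecStep β ν f = f :=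
  have h := contractingWith_corecStep β ν
  ⟨h.fixedPoint, h.fixedPoint_isFixedPt, fun _ hf => h.fixedPoint_unique hf⟩

theorem corecStep_eq_iff (B : Endofunctor.Coalgebra nTensor.{u}) (A : Endofunctor.Algebra nTensor)
    [IsIso A.str] (f : B.V ⟶ A.a) :
    corecStep B.str A.str f = f ↔ B.str ≫ nTensor.map f = f ≫ inv A.str := by
  rw [IsIso.eq_comp_inv, Category.assoc]
  rfl

/-- Finality by Banach's fixed point theorem: `corecStep` is a contraction of `B.V ⟶ A.a`. -/
noncomputable def invCoalgebraIsTerminal (A : Endofunctor.Algebra nTensor.{u}) [IsIso A.str]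
    [CompleteSpace A.a.carrier] (h : ∀ B : SquaMS.{u}, Nonempty (B ⟶ A.a)) :
    IsTerminal (invCoalgebra A) :=
  have hcorec (B : Endofunctor.Coalgebra nTensor) : ∃! f, corecStep B.str A.str f = f :=
    have := h B.V
    existsUnique_corecStep_eq B.str A.str
  IsTerminal.ofUniqueHom
    (fun B => ⟨(hcorec B).choose, (corecStep_eq_iff B A _).1 (hcorec B).choose_spec.1⟩)
    fun B f => Endofunctor.Coalgebra.Hom.ext
      ((hcorec B).choose_spec.2 f.f ((corecStep_eq_iff B A _).2 f.h))

end

/-! ### The unit square as a fixed point of `N ⊗ -` -/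

/-- The image of `t` in the `i`-th third of the unit interval. -/
noncomputable def shrink (i : Fin 3) (t : unitInterval) : unitInterval :=
  ⟨(i.val + t) / 3,
    div_nonneg (add_nonneg (Nat.cast_nonneg _) t.2.1) zero_le_three,
    (div_le_one three_pos).2 <| by
      have hi : (i.val : ℝ) ≤ 2 := by exact_mod_cast Nat.le_of_lt_succ i.2
      linarith [t.2.2]⟩

/-- The position of `t` inside its third of the unit interval. -/
noncomputable def expand (t : unitInterval) : unitInterval :=
  ⟨3 * t - (third t).val, third_mem t.2⟩

theorem shrink_third_expand (t : unitInterval) : shrink (third t) (expand t) = t :=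
  Subtype.ext (by simp [shrink, expand])

theorem shrink_clamp {i : Fin 3} {t : ℝ} (h : 3 * t - i.val ∈ Set.Icc (0 : ℝ) 1) :
    shrink i (clamp (3 * t - i.val)) = clamp t := by
  apply Subtype.ext
  rw [clamp_of_mem (mem_of_third h)]
  simp [shrink, clamp_of_mem h]

theorem dist_shrink (i : Fin 3) (s t : unitInterval) :
    dist (shrink i s) (shrink i t) = dist s t / 3 := by
  simp only [Subtype.dist_eq, Real.dist_eq, shrink]
  rw [← sub_div, add_sub_add_left_eq_sub, abs_div, abs_of_pos (zero_lt_three' ℝ)]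

theorem shrink_eq_cases {i k : Fin 3} {r t : unitInterval} (h : shrink i r = shrink k t) :
    (i = k ∧ r = t) ∨ ((r = 0 ∨ r = 1) ∧ (t = 0 ∨ t = 1)) := by
  have hsum : (i.val : ℝ) + r = k.val + t :=
    (div_left_inj' three_ne_zero).1 (congrArg Subtype.val h)
  rcases coord_cases r.2 t.2 hsum with ⟨hik, hrt⟩ | ⟨-, hr, ht⟩ | ⟨-, ht, hr⟩
  · exact Or.inl ⟨Fin.ext hik, Subtype.ext hrt⟩
  · exact Or.inr ⟨Or.inr (Subtype.ext hr), Or.inl (Subtype.ext ht)⟩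
  · exact Or.inr ⟨Or.inl (Subtype.ext hr), Or.inr (Subtype.ext ht)⟩

theorem dist_le_of_shrink {Y : Type*} [PseudoMetricSpace Y] {f : unitInterval → Y}
    (h : ∀ i s t, dist (f (shrink i s)) (f (shrink i t)) ≤ dist s t / 3) (s t : unitInterval) :
    dist (f s) (f t) ≤ dist s t := by
  have hthird : ∀ (i : Fin 3) (a b : ℝ), 3 * a - i.val ∈ Set.Icc (0 : ℝ) 1 →
      3 * b - i.val ∈ Set.Icc (0 : ℝ) 1 → dist (f (clamp a)) (f (clamp b)) ≤ |b - a| := by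
    intro i a b ha hb
    calc dist (f (clamp a)) (f (clamp b))
        ≤ dist (clamp (3 * a - i.val)) (clamp (3 * b - i.val)) / 3 := by
          rw [← shrink_clamp ha, ← shrink_clamp hb]
          exact h i _ _
      _ = dist (clamp a) (clamp b) := by
          rw [← dist_shrink i, shrink_clamp ha, shrink_clamp hb]
      _ = |b - a| := by
          rw [Subtype.dist_eq, clamp_of_mem (mem_of_third ha), clamp_of_mem (mem_of_third hb),
            dist_comm, Real.dist_eq]
  have hst := short_of_thirds (fun a => f (clamp a)) hthird s t s.2 t.2
  simp only [clamp, Set.projIcc_val] at hst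
  rwa [dist_comm s t]

theorem UnitSquare.dist_eq_add (u v : UnitSquare.{u}) :
    dist u v = dist u.fst v.fst + dist u.snd v.snd := rfl

theorem UnitSquare.dist_mk_same_fst (r s s' : unitInterval) :
    dist (⟨r, s⟩ : UnitSquare.{u}) ⟨r, s'⟩ = dist s s' := by
  rw [UnitSquare.dist_eq_add, dist_self, zero_add]

theorem UnitSquare.dist_mk_same_snd (r r' s : unitInterval) :
    dist (⟨r, s⟩ : UnitSquare.{u}) ⟨r', s⟩ = dist r r' := by
  rw [UnitSquare.dist_eq_add, dist_self, add_zero]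

/-- The position in the large square of the point `u` of the cell `n`. -/
noncomputable def cellPoint (n : N) (u : UnitSquare.{u}) : UnitSquare.{u} :=
  ⟨shrink n.1 u.fst, shrink n.2 u.snd⟩

theorem dist_cellPoint (n : N) (u v : UnitSquare.{u}) :
    dist (cellPoint n u) (cellPoint n v) = dist u v / 3 := by
  simp only [UnitSquare.dist_eq_add, cellPoint, dist_shrink, add_div]

theorem cellPoint_S_eq_iff {n m : N} {p q : M0} :
    cellPoint n (U0.{u}.S p) = cellPoint m (U0.{u}.S q) ↔ pos n p = pos m q := by
  simp [cellPoint, UnitSquare.ext_iff, pos, Prod.ext_iff, shrink, U0, Subtype.ext_iff,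
    div_left_inj']

theorem cellPoint_third_zoom (p : M0) :
    cellPoint (third p.1.1, third p.1.2) (U0.{u}.S (zoom p)) = U0.{u}.S p := by
  simp [cellPoint, shrink, U0, zoom]

theorem cellPoint_third_expand (u : UnitSquare.{u}) :
    cellPoint (third u.fst, third u.snd) ⟨expand u.fst, expand u.snd⟩ = u := by
  simp [cellPoint, shrink_third_expand]

theorem exists_S_eq {u : UnitSquare.{u}}
    (h : (u.fst = 0 ∨ u.fst = 1) ∨ (u.snd = 0 ∨ u.snd = 1)) : ∃ p, U0.{u}.S p = u := by
  refine ⟨⟨(u.fst, u.snd), ?_⟩, rfl⟩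
  rcases h with h | h
  · exact Or.inl ⟨h.imp (congrArg Subtype.val) (congrArg Subtype.val), u.snd.2⟩
  · exact Or.inr ⟨u.fst.2, h.imp (congrArg Subtype.val) (congrArg Subtype.val)⟩

theorem cellPoint_eq_cases {n m : N} {u v : UnitSquare.{u}} (h : cellPoint n u = cellPoint m v) :
    (n = m ∧ u = v) ∨ ∃ p q, U0.{u}.S p = u ∧ U0.{u}.S q = v ∧ pos n p = pos m q := by
  have of_boundary (hu : (u.fst = 0 ∨ u.fst = 1) ∨ (u.snd = 0 ∨ u.snd = 1))
      (hv : (v.fst = 0 ∨ v.fst = 1) ∨ (v.snd = 0 ∨ v.snd = 1)) :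
      ∃ p q, U0.{u}.S p = u ∧ U0.{u}.S q = v ∧ pos n p = pos m q := by
    obtain ⟨p, rfl⟩ := exists_S_eq hu
    obtain ⟨q, rfl⟩ := exists_S_eq hv
    exact ⟨p, q, rfl, rfl, cellPoint_S_eq_iff.1 h⟩
  rcases shrink_eq_cases (congrArg UnitSquare.fst h) with ⟨hn₁, hfst⟩ | ⟨hu, hv⟩
  · rcases shrink_eq_cases (congrArg UnitSquare.snd h) with ⟨hn₂, hsnd⟩ | ⟨hu, hv⟩
    · exact Or.inl ⟨Prod.ext hn₁ hn₂, UnitSquare.ext hfst hsnd⟩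
    · exact Or.inr (of_boundary (Or.inr hu) (Or.inr hv))
  · exact Or.inr (of_boundary (Or.inl hu) (Or.inl hv))

theorem tmk_eq_of_cellPoint_eq {n m : N} {u v : UnitSquare.{u}}
    (h : cellPoint n u = cellPoint m v) : tmk (X := U0.{u}) n u = tmk m v := by
  rcases cellPoint_eq_cases h with ⟨rfl, rfl⟩ | ⟨p, q, rfl, rfl, hpq⟩
  · rfl
  · exact tmk_eq_of_pos_eq hpq

/-- The morphism `N ⊗ U₀ ⟶ U₀` that takes a point of a cell to its position in the square. -/
noncomputable def squareStr : nTensor.obj U0.{u} ⟶ U0.{u} :=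
  tensorDesc (fun a => cellPoint a.1 a.2)
    (fun _ _ _ _ h => cellPoint_S_eq_iff.2 (pos_eq_of_glue h))
    (fun n x y => (dist_cellPoint n x y).le) cellPoint_third_zoom

/-- The inverse of `squareStr`. Points on a grid line lie in several cells; `third` chooses the
lower one. -/
noncomputable def subdivide (u : UnitSquare.{u}) : Tensor U0.{u} :=
  tmk (third u.fst, third u.snd) ⟨expand u.fst, expand u.snd⟩

theorem subdivide_cellPoint (n : N) (u : UnitSquare.{u}) :
    subdivide (cellPoint n u) = tmk (X := U0) n u :=
  tmk_eq_of_cellPoint_eq (cellPoint_third_expand _)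

theorem dist_subdivide_same_fst_le (r s s' : unitInterval) :
    dist (subdivide.{u} ⟨r, s⟩) (subdivide ⟨r, s'⟩) ≤ dist s s' := by
  have hline : ∀ j t, subdivide.{u} ⟨r, shrink j t⟩ =
      tmk (X := U0) (third r, j) (⟨expand r, t⟩ : UnitSquare) := fun j t => by
    rw [← subdivide_cellPoint, cellPoint, shrink_third_expand]
  refine dist_le_of_shrink (f := fun s => subdivide ⟨r, s⟩) (fun j t t' => ?_) s s'
  rw [hline, hline, ← UnitSquare.dist_mk_same_fst.{u} (expand r)]
  exact dist_tmk_same_le (X := U0.{u}) _ _ _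

theorem dist_subdivide_same_snd_le (r r' s : unitInterval) :
    dist (subdivide.{u} ⟨r, s⟩) (subdivide ⟨r', s⟩) ≤ dist r r' := by
  have hline : ∀ i t, subdivide.{u} ⟨shrink i t, s⟩ =
      tmk (X := U0) (i, third s) (⟨t, expand s⟩ : UnitSquare) := fun i t => by
    rw [← subdivide_cellPoint, cellPoint, shrink_third_expand]
  refine dist_le_of_shrink (f := fun r => subdivide ⟨r, s⟩) (fun i t t' => ?_) r r'
  rw [hline, hline, ← UnitSquare.dist_mk_same_snd.{u} _ _ (expand s)]
  exact dist_tmk_same_le (X := U0.{u}) _ _ _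

theorem dist_subdivide_le (u v : UnitSquare.{u}) : dist (subdivide u) (subdivide v) ≤ dist u v :=
  calc dist (subdivide u) (subdivide v)
      ≤ dist (subdivide u) (subdivide ⟨v.fst, u.snd⟩) +
          dist (subdivide ⟨v.fst, u.snd⟩) (subdivide v) := dist_triangle _ _ _
    _ ≤ dist u.fst v.fst + dist u.snd v.snd :=
      add_le_add (dist_subdivide_same_snd_le _ _ _) (dist_subdivide_same_fst_le _ _ _)

instance isIso_squareStr : IsIso squareStr.{u} := by
  refine ⟨⟨subdivide, dist_subdivide_le, fun p => ?_⟩, ?_, ?_⟩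
  · exact (congrArg subdivide (cellPoint_third_zoom p).symm).trans (subdivide_cellPoint _ _)
  · exact tensor_hom_ext subdivide_cellPoint
  · exact SquaMS.Hom.ext (funext cellPoint_third_expand)

/-- The unit square as an algebra of `N ⊗ -`. -/
noncomputable abbrev squareAlgebra : Endofunctor.Algebra nTensor.{u} where
  a := U0
  str := squareStr

/-! ### Finality of the unit square -/

theorem abs_half_add_add_abs_half_sub_le {a b c : ℝ} (ha : |a| ≤ c) (hb : |b| ≤ c) :
    |(a + b) / 2| + |(a - b) / 2| ≤ c := by
  rw [abs_le] at ha hb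
  rcases abs_cases ((a + b) / 2) with ⟨h, -⟩ | ⟨h, -⟩ <;>
    rcases abs_cases ((a - b) / 2) with ⟨h', -⟩ | ⟨h', -⟩ <;>
    rw [h, h'] <;> linarith [ha.1, ha.2, hb.1, hb.2]

/-- The coordinates `r + s` and `r - s` identify the taxicab metric with a supremum metric, so it is
enough to extend each of these two real-valued functions. -/
theorem nonempty_hom_U0 (X : SquaMS.{u}) : Nonempty (X ⟶ U0.{u}) := by
  obtain ⟨f, hf, hfS, -⟩ := exists_short X 1 1 abs_one abs_one
  obtain ⟨g, hg, hgS, -⟩ := exists_short X 1 (-1) abs_one (by rw [abs_neg, abs_one])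
  refine ⟨⟨fun x => ⟨clamp ((f x + g x) / 2), clamp ((f x - g x) / 2)⟩, fun x y => ?_,
    fun p => ?_⟩⟩
  · calc |(clamp ((f x + g x) / 2) : ℝ) - clamp ((f y + g y) / 2)| +
          |(clamp ((f x - g x) / 2) : ℝ) - clamp ((f y - g y) / 2)|
        ≤ |(f x + g x) / 2 - (f y + g y) / 2| + |(f x - g x) / 2 - (f y - g y) / 2| :=
          add_le_add (Set.abs_projIcc_sub_projIcc _) (Set.abs_projIcc_sub_projIcc _)
      _ = |((f x - f y) + (g x - g y)) / 2| + |((f x - f y) - (g x - g y)) / 2| := by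
          congr 2 <;> ring
      _ ≤ dist x y := abs_half_add_add_abs_half_sub_le (hf x y) (hg x y)
  · have hfst : (f (X.S p) + g (X.S p)) / 2 = p.1.1 := by rw [hfS, hgS]; ring
    have hsnd : (f (X.S p) - g (X.S p)) / 2 = p.1.2 := by rw [hfS, hgS]; ring
    simp only [hfst, hsnd]
    exact UnitSquare.ext (Subtype.ext (clamp_of_mem p.fst_mem))
      (Subtype.ext (clamp_of_mem p.snd_mem))

instance : CompactSpace UnitSquare.{u} := by
  let mk : unitInterval × unitInterval → UnitSquare.{u} := fun p => ⟨p.1, p.2⟩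
  have hmk : LipschitzWith 2 mk := LipschitzWith.of_dist_le_mul fun p q => by
    rw [UnitSquare.dist_eq_add, NNReal.coe_ofNat, two_mul]
    exact add_le_add (le_max_left _ _) (le_max_right _ _)
  have hsurj : Function.Surjective mk := fun u => ⟨(u.fst, u.snd), rfl⟩
  exact hsurj.compactSpace hmk.continuous

instance : CompleteSpace U0.{u}.carrier :=
  inferInstanceAs (CompleteSpace UnitSquare.{u})

/-! ### The triadic grid -/

/-- The triadic rational points of the unit interval. -/
inductive Triadic : unitInterval → Prop
  | zero : Triadic 0
  | one : Triadic 1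
  | shrink (i : Fin 3) {t : unitInterval} (h : Triadic t) : Triadic (shrink i t)

theorem exists_triadic_dist_le (s : unitInterval) (k : ℕ) :
    ∃ t, Triadic t ∧ dist s t ≤ (1 / 3) ^ k := by
  induction k generalizing s with
  | zero =>
    refine ⟨0, Triadic.zero, ?_⟩
    rw [Subtype.dist_eq, pow_zero]
    exact Real.dist_le_of_mem_Icc_01 s.2 unitInterval.zero_mem
  | succ k ih =>
    obtain ⟨t, ht, hd⟩ := ih (expand s)
    refine ⟨shrink (third s) t, ht.shrink _, ?_⟩
    calc dist s (shrink (third s) t) = dist (expand s) t / 3 := by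
          rw [← dist_shrink (third s), shrink_third_expand]
      _ ≤ (1 / 3) ^ k / 3 := by gcongr
      _ = (1 / 3) ^ (k + 1) := by ring

theorem dense_triadic : Dense {t | Triadic t} := by
  refine Metric.dense_iff.2 fun s ε hε => ?_
  obtain ⟨k, hk⟩ := exists_pow_lt_of_lt_one hε (show (1 / 3 : ℝ) < 1 by norm_num)
  obtain ⟨t, ht, hd⟩ := exists_triadic_dist_le s k
  exact ⟨t, Metric.mem_ball'.2 (hd.trans_lt hk), ht⟩

/-- The points of the unit square on a vertical or horizontal line at a triadic rational
position. -/
def OnGrid (u : UnitSquare.{u}) : Prop := Triadic u.fst ∨ Triadic u.snd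

theorem OnGrid.cellPoint {u : UnitSquare.{u}} (h : OnGrid u) (n : N) : OnGrid (cellPoint n u) :=
  h.imp (fun h => h.shrink _) (fun h => h.shrink _)

theorem onGrid_S (p : M0) : OnGrid (U0.{u}.S p) := by
  have hend : ∀ (x : ℝ) (hx : x ∈ Set.Icc (0 : ℝ) 1), x = 0 ∨ x = 1 → Triadic ⟨x, hx⟩ := by
    rintro x hx (rfl | rfl)
    exacts [Triadic.zero, Triadic.one]
  exact p.2.imp (fun h => hend _ _ h.1) (fun h => hend _ _ h.2)

/-- The square metric space of the points of the unit square on a triadic line, with the taxicab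
metric. -/
noncomputable def grid : SquaMS.{u} where
  carrier := {u : UnitSquare.{u} // OnGrid u}
  S p := ⟨U0.S p, onGrid_S p⟩
  S_injective _ _ h := U0.{u}.S_injective (congrArg Subtype.val h)
  dist_le_two u v := U0.{u}.dist_le_two u.1 v.1
  dist_vertical := U0.{u}.dist_vertical
  dist_horizontal := U0.{u}.dist_horizontal
  taxi_le_dist := U0.{u}.taxi_le_dist

/-- The inclusion of the triadic grid into the unit square. -/
noncomputable def gridInclusion : grid.{u} ⟶ U0.{u} where
  toFun := Subtype.val
  short _ _ := le_rfl
  map_S _ := rfl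

theorem isometry_gridInclusion : Isometry gridInclusion.{u}.toFun := isometry_subtype_coe

theorem denseRange_gridInclusion : DenseRange gridInclusion.{u}.toFun := by
  refine Metric.dense_iff.2 fun u ε hε => ?_
  obtain ⟨t, ht, hd⟩ := dense_triadic.exists_dist_lt u.fst hε
  refine ⟨⟨t, u.snd⟩, ?_, ⟨⟨⟨t, u.snd⟩, Or.inl ht⟩, rfl⟩⟩
  exact Metric.mem_ball'.2 ((UnitSquare.dist_mk_same_snd.{u} u.fst t u.snd).trans_lt hd)

/-- The morphism `N ⊗ grid ⟶ grid` that takes a point of a cell to its position in the square. -/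
noncomputable def gridStr : nTensor.obj grid.{u} ⟶ grid.{u} :=
  tensorDesc (fun a => ⟨cellPoint a.1 a.2.1, a.2.2.cellPoint a.1⟩)
    (fun _ _ _ _ h => Subtype.ext (cellPoint_S_eq_iff.2 (pos_eq_of_glue h)))
    (fun n x y => (dist_cellPoint n x.1 y.1).le) fun p => Subtype.ext (cellPoint_third_zoom p)

/-- The triadic grid as an algebra of `N ⊗ -`. -/
noncomputable abbrev gridAlgebra : Endofunctor.Algebra nTensor.{u} where
  a := grid
  str := gridStr

/-- The inclusion of the triadic grid into the unit square as a morphism of algebras. -/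
noncomputable def gridAlgebraInclusion : gridAlgebra.{u} ⟶ squareAlgebra.{u} where
  f := gridInclusion
  h := tensor_hom_ext fun _ _ => rfl

section

variable {Y : Type*} [PseudoMetricSpace Y] {f : grid.{u}.carrier → Y}

/-- Shortness along each vertical and horizontal line at a triadic rational position. -/
structure IsShortOnTriadicLines (f : grid.{u}.carrier → Y) : Prop where
  vertical {r : unitInterval} (hr : Triadic r) (s s' : unitInterval) :
    dist (f ⟨⟨r, s⟩, Or.inl hr⟩) (f ⟨⟨r, s'⟩, Or.inl hr⟩) ≤ dist s s'
  horizontal {s : unitInterval} (hs : Triadic s) (r r' : unitInterval) :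
    dist (f ⟨⟨r, s⟩, Or.inr hs⟩) (f ⟨⟨r', s⟩, Or.inr hs⟩) ≤ dist r r'

namespace IsShortOnTriadicLines

theorem exists_node_dist_lt (h : IsShortOnTriadicLines f) (u : grid.{u}.carrier) {ε : ℝ}
    (hε : 0 < ε) :
    ∃ c : grid.{u}.carrier, (Triadic c.1.fst ∧ Triadic c.1.snd) ∧ dist u c < ε ∧
      dist (f u) (f c) ≤ dist u c := by
  obtain ⟨⟨r, s⟩, hr | hs⟩ := u
  · obtain ⟨t, ht, hst⟩ := dense_triadic.exists_dist_lt s hε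
    have hdist := UnitSquare.dist_mk_same_fst.{u} r s t
    exact ⟨⟨⟨r, t⟩, Or.inl hr⟩, ⟨hr, ht⟩, hdist.trans_lt hst,
      (h.vertical hr s t).trans_eq hdist.symm⟩
  · obtain ⟨t, ht, hrt⟩ := dense_triadic.exists_dist_lt r hε
    have hdist := UnitSquare.dist_mk_same_snd.{u} r t s
    exact ⟨⟨⟨t, s⟩, Or.inr hs⟩, ⟨ht, hs⟩, hdist.trans_lt hrt,
      (h.horizontal hs r t).trans_eq hdist.symm⟩

theorem dist_node_le (h : IsShortOnTriadicLines f) {c d : grid.{u}.carrier}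
    (hc : Triadic c.1.snd) (hd : Triadic d.1.fst) : dist (f c) (f d) ≤ dist c d :=
  calc dist (f c) (f d)
      ≤ dist (f c) (f ⟨⟨d.1.fst, c.1.snd⟩, Or.inr hc⟩) +
          dist (f ⟨⟨d.1.fst, c.1.snd⟩, Or.inr hc⟩) (f d) := dist_triangle _ _ _
    _ ≤ dist c.1.fst d.1.fst + dist c.1.snd d.1.snd :=
      add_le_add (h.horizontal hc _ _) (h.vertical hd _ _)

/-- Two intersection points of triadic lines are opposite corners of a rectangle with triadic sides,
and every point of the grid is a limit of intersection points along the line it lies on. -/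
theorem dist_le (h : IsShortOnTriadicLines f) (u v : grid.{u}.carrier) :
    dist (f u) (f v) ≤ dist u v := by
  refine le_of_forall_pos_le_add fun ε hε => ?_
  obtain ⟨c, ⟨-, hc⟩, huc, hfuc⟩ := h.exists_node_dist_lt u (show 0 < ε / 4 by positivity)
  obtain ⟨d, ⟨hd, -⟩, hvd, hfvd⟩ := h.exists_node_dist_lt v (show 0 < ε / 4 by positivity)
  have hcd := h.dist_node_le hc hd
  have hf := dist_triangle4_right (f u) (f v) (f c) (f d)
  have huv := dist_triangle4_left u v c d
  linarith

end IsShortOnTriadicLines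

end

/-! ### Initiality of the triadic grid -/

section

variable {Y : SquaMS.{u}} {ν : nTensor.obj Y ⟶ Y}

variable (ν) in
/-- The graph of the algebra morphism from the triadic grid to `(Y, ν)`. It is defined as a relation
because a point of the grid can be reached from the boundary through different cells. -/
inductive DescGraph : UnitSquare.{u} → Y.carrier → Prop
  | boundary (p : M0) : DescGraph (U0.{u}.S p) (Y.S p)
  | cell (n : N) {u : UnitSquare.{u}} {y : Y.carrier} : DescGraph u y →
    DescGraph (cellPoint n u) (ν.toFun (tmk n y))

theorem DescGraph.eq_S {u : UnitSquare.{u}} {y : Y.carrier} (h : DescGraph ν u y) {p : M0}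
    (hu : u = U0.{u}.S p) : y = Y.S p := by
  induction h generalizing p with
  | boundary q => rw [U0.{u}.S_injective hu]
  | @cell n u y _ ih =>
    have hp : ν.toFun (tmk (third p.1.1, third p.1.2) (Y.S (zoom p))) = Y.S p := ν.map_S p
    rw [← hp]
    rcases cellPoint_eq_cases (hu.trans (cellPoint_third_zoom p).symm) with
      ⟨rfl, hu'⟩ | ⟨q, q', hq, hq', hpos⟩
    · rw [ih hu']
    · obtain rfl := U0.{u}.S_injective hq'
      rw [ih hq.symm, tmk_eq_of_pos_eq hpos]

theorem DescGraph.unique {u : UnitSquare.{u}} {y y' : Y.carrier} (h : DescGraph ν u y)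
    (h' : DescGraph ν u y') : y = y' := by
  induction h generalizing y' with
  | boundary p => exact (h'.eq_S rfl).symm
  | @cell n u y h ih =>
    generalize hv : cellPoint n u = v at h'
    cases h' with
    | boundary p => exact (h.cell n).eq_S hv
    | @cell m u' y' h' =>
      rcases cellPoint_eq_cases hv with ⟨rfl, rfl⟩ | ⟨p, q, hp, hq, hpos⟩
      · rw [ih h']
      · rw [h.eq_S hp.symm, h'.eq_S hq.symm, tmk_eq_of_pos_eq hpos]

variable (ν) in
/-- A line `ℓ` over which the graph `DescGraph ν` is defined and short. -/
def HasShortSection (ℓ : unitInterval → UnitSquare.{u}) : Prop :=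
  ∃ v : unitInterval → Y.carrier, (∀ s, DescGraph ν (ℓ s) (v s)) ∧
    ∀ s t, dist (v s) (v t) ≤ dist s t

theorem DescGraph.dist_le_of_hasShortSection {ℓ : unitInterval → UnitSquare.{u}}
    (hℓ : HasShortSection ν ℓ) {s t : unitInterval} {y z : Y.carrier}
    (hy : DescGraph ν (ℓ s) y) (hz : DescGraph ν (ℓ t) z) : dist y z ≤ dist s t := by
  obtain ⟨v, hv, hshort⟩ := hℓ
  rw [hy.unique (hv s), hz.unique (hv t)]
  exact hshort s t

theorem HasShortSection.boundary {e : unitInterval → M0}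
    (he : ∀ s t, dist (Y.S (e s)) (Y.S (e t)) ≤ dist s t) :
    HasShortSection ν fun s => U0.{u}.S (e s) :=
  ⟨fun s => Y.S (e s), fun s => .boundary (e s), he⟩

theorem HasShortSection.of_cellPoint {ℓ ℓ' : unitInterval → UnitSquare.{u}} {c : Fin 3 → N}
    (hℓ : HasShortSection ν ℓ) (hℓ' : ∀ j s, cellPoint (c j) (ℓ s) = ℓ' (shrink j s)) :
    HasShortSection ν ℓ' := by
  obtain ⟨v, hv, hshort⟩ := hℓ
  have hcell : ∀ j s, DescGraph ν (ℓ' (shrink j s)) (ν.toFun (tmk (c j) (v s))) := fun j s =>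
    hℓ' j s ▸ (hv s).cell (c j)
  let w : unitInterval → Y.carrier := fun s => ν.toFun (tmk (c (third s)) (v (expand s)))
  have hw : ∀ s, DescGraph ν (ℓ' s) (w s) := fun s => by
    simpa only [shrink_third_expand] using hcell (third s) (expand s)
  refine ⟨w, hw, dist_le_of_shrink fun j s t => ?_⟩
  calc dist (w (shrink j s)) (w (shrink j t))
      = dist (ν.toFun (tmk (c j) (v s))) (ν.toFun (tmk (c j) (v t))) := by
        rw [(hw _).unique (hcell j s), (hw _).unique (hcell j t)]
    _ ≤ dist (v s) (v t) / 3 := dist_toFun_tmk_le ν _ _ _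
    _ ≤ dist s t / 3 := by gcongr; exact hshort s t

theorem Triadic.hasShortSection_vertical {r : unitInterval} (hr : Triadic r) :
    HasShortSection ν fun s => ⟨r, s⟩ := by
  have of_side (r : unitInterval) (hr : (r : ℝ) = 0 ∨ (r : ℝ) = 1) :
      HasShortSection ν fun s => ⟨r, s⟩ := by
    let e : unitInterval → M0 := fun s => ⟨(r, s), Or.inl ⟨hr, s.2⟩⟩
    exact .boundary (e := e) fun x y =>
      ((Y.dist_vertical (e x) (e y) rfl hr).trans (abs_sub_comm _ _)).le
  induction hr with
  | zero => exact of_side 0 (Or.inl rfl)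
  | one => exact of_side 1 (Or.inr rfl)
  | shrink i _ ih => exact ih.of_cellPoint (c := fun j => (i, j)) fun _ _ => rfl

theorem Triadic.hasShortSection_horizontal {s : unitInterval} (hs : Triadic s) :
    HasShortSection ν fun r => ⟨r, s⟩ := by
  have of_side (s : unitInterval) (hs : (s : ℝ) = 0 ∨ (s : ℝ) = 1) :
      HasShortSection ν fun r => ⟨r, s⟩ := by
    let e : unitInterval → M0 := fun r => ⟨(r, s), Or.inr ⟨r.2, hs⟩⟩
    exact .boundary (e := e) fun x y =>
      ((Y.dist_horizontal (e x) (e y) rfl hs).trans (abs_sub_comm _ _)).le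
  induction hs with
  | zero => exact of_side 0 (Or.inl rfl)
  | one => exact of_side 1 (Or.inr rfl)
  | shrink j _ ih => exact ih.of_cellPoint (c := fun i => (i, j)) fun _ _ => rfl

theorem OnGrid.exists_descGraph {u : UnitSquare.{u}} (hu : OnGrid u) : ∃ y, DescGraph ν u y := by
  rcases hu with h | h
  · obtain ⟨v, hv, -⟩ := h.hasShortSection_vertical (ν := ν)
    exact ⟨_, hv u.snd⟩
  · obtain ⟨v, hv, -⟩ := h.hasShortSection_horizontal (ν := ν)
    exact ⟨_, hv u.fst⟩

variable (ν) in
/-- The algebra morphism from the triadic grid to `(Y, ν)`. -/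
noncomputable def gridDesc : grid.{u} ⟶ Y where
  toFun u := (u.2.exists_descGraph (ν := ν)).choose
  short := IsShortOnTriadicLines.dist_le
    { vertical := fun hr _ _ => DescGraph.dist_le_of_hasShortSection hr.hasShortSection_vertical
        (Exists.choose_spec _) (Exists.choose_spec _)
      horizontal := fun hs _ _ => DescGraph.dist_le_of_hasShortSection
        hs.hasShortSection_horizontal (Exists.choose_spec _) (Exists.choose_spec _) }
  map_S p := (grid.{u}.S p).2.exists_descGraph.choose_spec.eq_S rfl

theorem descGraph_gridDesc (u : grid.{u}.carrier) : DescGraph ν u.1 ((gridDesc ν).toFun u) :=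
  u.2.exists_descGraph.choose_spec

theorem map_gridDesc_comp : nTensor.map (gridDesc ν) ≫ ν = gridStr ≫ gridDesc ν :=
  tensor_hom_ext fun n u =>
    ((descGraph_gridDesc u).cell n).unique (descGraph_gridDesc (gridStr.toFun (tmk n u)))

theorem DescGraph.toFun_eq {f : grid.{u} ⟶ Y} (hf : nTensor.map f ≫ ν = gridStr ≫ f)
    {u : UnitSquare.{u}} {y : Y.carrier} (h : DescGraph ν u y) : ∃ hu, f.toFun ⟨u, hu⟩ = y := by
  induction h with
  | boundary p => exact ⟨onGrid_S p, f.map_S p⟩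
  | @cell n u y h ih =>
    obtain ⟨hu, rfl⟩ := ih
    exact ⟨hu.cellPoint n, (SquaMS.Hom.congr_toFun hf (tmk n ⟨u, hu⟩)).symm⟩

theorem eq_gridDesc {f : grid.{u} ⟶ Y} (hf : nTensor.map f ≫ ν = gridStr ≫ f) :
    f = gridDesc ν :=
  SquaMS.Hom.ext (funext fun u => ((descGraph_gridDesc u).toFun_eq hf).2)

end

/-- Initiality of the triadic grid, with `gridDesc` as the universal morphism. -/
noncomputable def gridAlgebraIsInitial : IsInitial gridAlgebra.{u} :=
  IsInitial.ofUniqueHom (fun A => ⟨gridDesc A.str, map_gridDesc_comp⟩)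
    fun _ f => Endofunctor.Algebra.Hom.ext (eq_gridDesc f.h)

/-! ### Completions of algebras -/

section

open UniformSpace

variable {X Y : SquaMS.{u}}

instance : CompleteSpace (completionFunctor.obj X).carrier :=
  inferInstanceAs (CompleteSpace (Completion X.carrier))

/-- The extension to the completion of a morphism into a complete square metric space. -/
noncomputable def completionDesc (j : X ⟶ Y) [CompleteSpace Y.carrier] :
    completionFunctor.obj X ⟶ Y where
  toFun := Completion.extension j.toFun
  short x y := ((SquaMS.Hom.lipschitz j).completion_extension.dist_le_mul x y).trans
    (one_mul (dist x y)).le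
  map_S p := (Completion.extension_coe (SquaMS.Hom.lipschitz j).uniformContinuous _).trans
    (j.map_S p)

theorem completionDesc_coe (j : X ⟶ Y) [CompleteSpace Y.carrier] (x : X.carrier) :
    (completionDesc j).toFun (x : Completion X.carrier) = j.toFun x :=
  Completion.extension_coe (SquaMS.Hom.lipschitz j).uniformContinuous x

theorem isIso_completionDesc {j : X ⟶ Y} [CompleteSpace Y.carrier] (hj : Isometry j.toFun)
    (hd : DenseRange j.toFun) : IsIso (completionDesc j) := by
  have hisom : Isometry (completionDesc j).toFun := hj.completion_extension
  have hsub : Set.range j.toFun ⊆ Set.range (completionDesc j).toFun := by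
    rintro _ ⟨x, rfl⟩
    exact ⟨_, completionDesc_coe j x⟩
  have hclosed : IsClosed (Set.range (completionDesc j).toFun) :=
    hisom.isUniformInducing.isComplete_range.isClosed
  exact SquaMS.isIso_iff.2
    ⟨hisom, Set.range_eq_univ.1 (hclosed.closure_eq ▸ (hd.mono hsub).closure_eq)⟩

theorem theta_coe (A : Endofunctor.Algebra nTensor.{u}) (n : N) (x : A.a.carrier) :
    (theta A).toFun (tmk (X := completion A.a) n (x : Completion A.a.carrier)) =
      (A.str.toFun (tmk n x) : Completion A.a.carrier) := by
  change Completion.map A.str.toFun (comparisonFun A.a (n, (x : Completion A.a.carrier))) = _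
  rw [comparisonFun_coe]
  exact Completion.map_coe (SquaMS.Hom.lipschitz A.str).uniformContinuous _

theorem tensor_completion_hom_ext {f g : tensor (completion X) ⟶ Y}
    (h : ∀ n (x : X.carrier), f.toFun (tmk n (x : Completion X.carrier)) =
      g.toFun (tmk n (x : Completion X.carrier))) : f = g := by
  have hcont (n : N) (f : tensor (completion X) ⟶ Y) :
      Continuous fun x : Completion X.carrier => f.toFun (tmk n x) :=
    (SquaMS.Hom.lipschitz f).continuous.comp (tmk_lipschitz (X := completion X) n).continuous
  exact tensor_hom_ext fun n x => Completion.induction_on (α := X.carrier) x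
    (isClosed_eq (hcont n f) (hcont n g)) (h n)

/-- The algebra `(C W, θ)` obtained from the algebra `A = (W, λ)`. -/
noncomputable abbrev completionAlgebra (A : Endofunctor.Algebra nTensor.{u}) :
    Endofunctor.Algebra nTensor.{u} where
  a := completionFunctor.obj A.a
  str := theta A

/-- The extension to the completion of a morphism into a complete algebra. -/
noncomputable def completionAlgebraDesc {A A' : Endofunctor.Algebra nTensor.{u}} (j : A ⟶ A')
    [CompleteSpace A'.a.carrier] : completionAlgebra A ⟶ A' where
  f := completionDesc j.f
  h := tensor_completion_hom_ext fun n x => by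
    change A'.str.toFun (tmk n ((completionDesc j.f).toFun (x : Completion A.a.carrier))) =
      (completionDesc j.f).toFun ((theta A).toFun
        (tmk (X := completion A.a) n (x : Completion A.a.carrier)))
    rw [theta_coe, completionDesc_coe, completionDesc_coe]
    exact SquaMS.Hom.congr_toFun j.h (tmk n x)

/-- Density and completeness make `completionAlgebraDesc j` an isomorphism. -/
noncomputable def completionAlgebraIso {A A' : Endofunctor.Algebra nTensor.{u}} (j : A ⟶ A')
    [CompleteSpace A'.a.carrier] (hj : Isometry j.f.toFun) (hd : DenseRange j.f.toFun) :
    completionAlgebra A ≅ A' :=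
  have : IsIso (completionAlgebraDesc j).f := isIso_completionDesc hj hd
  have := Endofunctor.Algebra.iso_of_iso (completionAlgebraDesc j)
  asIso (completionAlgebraDesc j)

end

/-- The completion of an initial algebra is the unit square: an initial algebra is isomorphic to the
triadic grid, which is dense in the square. -/
noncomputable def completionAlgebraIsoOfIsInitial {A : Endofunctor.Algebra nTensor.{u}}
    (hA : IsInitial A) : completionAlgebra A ≅ squareAlgebra.{u} :=
  let e : A ≅ gridAlgebra.{u} := hA.uniqueUpToIso gridAlgebraIsInitial
  have he := SquaMS.isIso_iff.1 ((Endofunctor.Algebra.forget nTensor).mapIso e).isIso_hom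
  completionAlgebraIso (e.hom ≫ gridAlgebraInclusion) (isometry_gridInclusion.comp he.1)
    (denseRange_gridInclusion.comp he.2.denseRange isometry_gridInclusion.continuous)

end SquareMetric

/-- The functor `N ⊗ -` on square metric spaces has an initial algebra. For every initial algebra
`(W, λ)`, with Cauchy completion `V = C W`, the induced morphism `θ : N ⊗ V ⟶ V` is an isomorphism,
`(V, θ⁻¹)` is a final coalgebra for `N ⊗ -`, and `V` is isomorphic to the unit square `U₀` with the
taxicab metric. -/
theorem mainTheorem5 :
    HasInitial (Endofunctor.Algebra SquareMetric.nTensor.{u}) ∧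
    ∀ A : Endofunctor.Algebra SquareMetric.nTensor.{u}, Nonempty (IsInitial A) →
      ∃ _ : IsIso (SquareMetric.theta A),
        Nonempty (IsTerminal
          ({ V := SquareMetric.completionFunctor.obj A.a
             str := inv (SquareMetric.theta A) } :
            Endofunctor.Coalgebra SquareMetric.nTensor.{u})) ∧
        Nonempty (SquareMetric.completionFunctor.obj A.a ≅ SquareMetric.U0.{u}) := by
  refine ⟨SquareMetric.gridAlgebraIsInitial.hasInitial, ?_⟩
  rintro A ⟨hA⟩
  let e := SquareMetric.completionAlgebraIsoOfIsInitial hA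
  have hθ : IsIso (SquareMetric.theta A) := SquareMetric.isIso_str_of_iso e
  have hfinal : IsTerminal (SquareMetric.invCoalgebra SquareMetric.squareAlgebra.{u}) :=
    SquareMetric.invCoalgebraIsTerminal _ SquareMetric.nonempty_hom_U0
  exact ⟨hθ, ⟨hfinal.ofIso (SquareMetric.invCoalgebraIso e).symm⟩,
    ⟨(Endofunctor.Algebra.forget _).mapIso e⟩⟩
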